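/- **Setting.** Let $H$ be a Hermitian operator, $L_1,\dots,L_J$ operators and $\rho_0$ a density operator on a finite-dimensional Hilbert space, and let $\rho(t)$ solve the Lindblad equation $\rho'=\mathcal L\rho$, $\rho(0)=\rho_0$, where $\mathcal L\rho=-i[H,\rho]+\sum_{j}\bigl(L_j\rho L_j^\dagger-\tfrac12\{L_j^\dagger L_j,\rho\}\bigr)$. Let $l\ge 2\|H\|+2\sum_j\|L_j\|^2$ (operator norms), and let $O$ be a Hermitian observable. For a step size $\tau$ the dilated-Hamiltonian step is $$\mathcal K_{H,L}(\tau)\rho=\operatorname{tr}_A\bigl(e^{-iH(\tau)}(|0\rangle\langle0|\otimes\rho)e^{iH(\tau)}\bigr),\qquad H(\tau)=\tau\,|0\rangle\langle 0|\otimes H+\sqrt\tau\sum_{j=1}^J\bigl(|j\rangle\langle0|\otimes L_j+|0\rangle\langle j|\otimes L_j^\dagger\bigr),$$ with an ancilla spanned by $|0\rangle,\dots,|J\rangle$. For a simulation time $T\ge1$, time is rescaled to $[0,1]$, so that the generator becomes $T\mathcal L$; for $\tau=1/k$, $k\in\mathbb N$, put $$f(\tau)=\operatorname{tr}\bigl(\mathcal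 K_{TH,\sqrt T L}(\tau)^{k}\rho_0\,O\bigr),\qquad f(0)=\operatorname{tr}(\rho(T)O).$$ On an interval $[0,a]$ the Chebyshev nodes are $\xi_j=\frac a2\bigl(1-\cos\frac{(2j-1)\pi}{2n+2}\bigr)$, $1\le j\le n+1$, and the perturbed nodes are $\tau_j=1/k_j$ with $k_j=\lceil1/\xi_j\rceil$. At each $\tau_j$ the state is prepared with $k_j$ steps and $O$ is measured $N_S$ times, all $(n+1)N_S$ shots being independent (a shot is a projective measurement, with values in the spectrum of $O$). Let $p_n$ be the polynomial of degree at most $n$ that interpolates the $n+1$ empirical means at $\tau_1,\dots,\tau_{n+1}$. Depth is counted in applications of the one-step channel, so the maximum circuit depth is $d_{\max}=\max_jk_j$. **Theorem.** Let $l_0>1$ and $M>0$. There is $A>0$, and for every real $B$ there are $c\in(0,1]$ and $C_N,c_1,C_2>0$, all depending only on $l_0$, $M$ (and, except for $A$, on $B$), such that the following holds for all systems as above (any dimension, any $J$) with $l\ge l_0$, $\|O\|\le M$, $T\ge1$, and all $0<\varepsilon\le e^{-1}$ with $$T\ \ge\ \frac{\log(1/\varepsilon)\sqrt{\log\log(1/\varepsilon)}}{l\sqrt{\log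 l}} .$$ Put $a=\dfrac{c}{(lT)^2\log l}$, and let $n\in\mathbb N$ satisfy $n\ge A\log(1/\varepsilon)$ and, in addition, $n\le B\log(1/\varepsilon)$ or $2a\,n^2\log n<1$. Then: 1. $0<\tau_1<\tau_2<\dots<\tau_{n+1}<a$. 2. For all $0<\delta<1$ and all $N_S\ge C_N\,\varepsilon^{-2}\log(2/\delta)$, $$\mathbb P\bigl(|p_n(0)-f(0)|<\varepsilon\bigr)>1-\delta .$$ 3. $d_{\max}=1/\tau_1$ and $c_1(lT)^2\log l\;n^2\le d_{\max}\le C_2(lT)^2\log l\;n^2$. If $n\le B\log(1/\varepsilon)$, then moreover $d_{\max}\le C_2\,(lT)^2\log l\,\log^2(1/\varepsilon)$. -/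

import Mathlib

open scoped Kronecker ComplexOrder

/-- The algebra of operators on a `d`-dimensional system. -/
abbrev Op (d : ℕ) := Matrix (Fin d) (Fin d) ℂ

/-- The operator (spectral) norm of a square complex matrix. -/
noncomputable def opNorm {d : ℕ} (A : Op d) : ℝ :=
  ‖Matrix.toEuclideanCLM (n := Fin d) (𝕜 := ℂ) A‖

/-- Density operators: positive semidefinite with unit trace. -/
def IsDensity {d : ℕ} (ρ : Op d) : Prop :=
  ρ.PosSemidef ∧ ρ.trace = 1

/-- The Lindblad generator
`ℒ ρ = -i[H, ρ] + ∑ⱼ (Lⱼ ρ Lⱼ† - ½ {Lⱼ† Lⱼ, ρ})`, the rates being absorbed into the `Lⱼ`. -/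
noncomputable def lindbladian {d J : ℕ} (H : Op d) (L : Fin J → Op d) (ρ : Op d) : Op d :=
  (-Complex.I) • (H * ρ - ρ * H) +
    ∑ j, (L j * ρ * (L j).conjTranspose -
      (1 / 2 : ℂ) • ((L j).conjTranspose * L j * ρ + ρ * ((L j).conjTranspose * L j)))

/-- The quantity `2 ‖H‖ + 2 ∑ⱼ ‖Lⱼ‖²` that controls the generator. -/
noncomputable def generatorSize {d J : ℕ} (H : Op d) (L : Fin J → Op d) : ℝ :=
  2 * opNorm H + 2 * ∑ j, opNorm (L j) ^ 2

/-- `ρ` solves the Lindblad equation `dρ/dt = ℒ ρ` on `[0, T]` with initial value `ρ₀`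
(the derivative is taken entrywise). -/
def IsLindbladSolution {d J : ℕ} (H : Op d) (L : Fin J → Op d) (T : ℝ) (ρ₀ : Op d)
    (ρ : ℝ → Op d) : Prop :=
  ρ 0 = ρ₀ ∧ ∀ t ∈ Set.Icc 0 T, ∀ i j : Fin d,
    HasDerivWithinAt (fun s => ρ s i j) (lindbladian H L (ρ t) i j) (Set.Icc 0 T) t

/-! ### The dilated-Hamiltonian integrator -/

/-- Operators on ancilla ⊗ system; the ancilla has the basis `|0⟩, |1⟩, …, |J⟩`. -/
abbrev DilatedOp (J d : ℕ) := Matrix (Fin (J + 1) × Fin d) (Fin (J + 1) × Fin d) ℂ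

/-- The matrix unit `|a⟩⟨b|` of the ancilla. -/
def ketBra {J : ℕ} (a b : Fin (J + 1)) : Matrix (Fin (J + 1)) (Fin (J + 1)) ℂ :=
  Matrix.single a b 1

/-- `H₀ = |0⟩⟨0| ⊗ H`. -/
def dilationH0 {d : ℕ} (J : ℕ) (H : Op d) : DilatedOp J d :=
  ketBra (J := J) 0 0 ⊗ₖ H

/-- `H₁ = ∑ⱼ (|j⟩⟨0| ⊗ Lⱼ + |0⟩⟨j| ⊗ Lⱼ†)`, the sum being over `j = 1, …, J`. -/
def dilationH1 {d J : ℕ} (L : Fin J → Op d) : DilatedOp J d :=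
  ∑ j : Fin J, (ketBra j.succ 0 ⊗ₖ L j + ketBra 0 j.succ ⊗ₖ (L j).conjTranspose)

/-- The dilated Hamiltonian `τ H₀ + √τ H₁` of one step of size `τ`. -/
noncomputable def dilatedHamiltonian {d J : ℕ} (H : Op d) (L : Fin J → Op d) (τ : ℝ) :
    DilatedOp J d :=
  (τ : ℂ) • dilationH0 J H + ((Real.sqrt τ : ℝ) : ℂ) • dilationH1 L

/-- The partial trace over the ancilla. -/
def traceAncilla {d J : ℕ} (X : DilatedOp J d) : Op d :=
  Matrix.of fun i k => ∑ a : Fin (J + 1), X (a, i) (a, k)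

/-- One step of size `τ`:
`𝒦(τ) ρ = tr_A (e^{-i H(τ)} (|0⟩⟨0| ⊗ ρ) e^{i H(τ)})`, with `H(τ)` the dilated Hamiltonian. -/
noncomputable def dilationStep {d J : ℕ} (H : Op d) (L : Fin J → Op d) (τ : ℝ) (ρ : Op d) :
    Op d :=
  traceAncilla
    (NormedSpace.exp ((-Complex.I) • dilatedHamiltonian H L τ) *
      (ketBra (J := J) 0 0 ⊗ₖ ρ) *
      NormedSpace.exp (Complex.I • dilatedHamiltonian H L τ))

/-- The simulated state at the final time. The evolution over `[0, T]` is rescaled to `s = t / T`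
in `[0, 1]`, so that the generator becomes `T ℒ` (Hamiltonian `T H`, jump operators `√T Lⱼ`); the
step size is `τ = 1 / k`, and `k` successive steps are applied to `ρ₀`. -/
noncomputable def simulatedState {d J : ℕ} (H : Op d) (L : Fin J → Op d) (T : ℝ) (ρ₀ : Op d)
    (k : ℕ) : Op d :=
  (dilationStep ((T : ℂ) • H) (fun j => ((Real.sqrt T : ℝ) : ℂ) • L j) (1 / (k : ℝ)))^[k] ρ₀

/-! ### Perturbed Chebyshev nodes and extrapolation -/

/-- The `n + 1` Chebyshev nodes `ξ₁ < … < ξ_{n+1}` of the first kind on `[0, a]`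
(the index `j : Fin (n + 1)` starts at `0`, so the angle is `(2 j + 1) π / (2 n + 2)`). -/
noncomputable def chebNode (a : ℝ) (n : ℕ) (j : Fin (n + 1)) : ℝ :=
  a / 2 * (1 - Real.cos ((2 * (j : ℝ) + 1) / (2 * (n : ℝ) + 2) * Real.pi))

/-- The number of steps `kⱼ = ⌈1 / ξⱼ⌉` used at the `j`-th node. -/
noncomputable def stepCount (a : ℝ) (n : ℕ) (j : Fin (n + 1)) : ℕ :=
  ⌈1 / chebNode a n j⌉₊

/-- The perturbed Chebyshev nodes `τⱼ = 1 / kⱼ`, for which `1 / τⱼ` is an integer. -/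
noncomputable def node (a : ℝ) (n : ℕ) (j : Fin (n + 1)) : ℝ :=
  1 / (stepCount a n j : ℝ)

/-- The maximum circuit depth, counted in successive applications of the one-step channel: the
largest number of steps among the `n + 1` circuits that are run. -/
noncomputable def maxDepth (a : ℝ) (n : ℕ) : ℕ :=
  Finset.univ.sup (stepCount a n)

/-- Richardson extrapolation: the value at `0` of the polynomial of degree at most `n` that
interpolates the data `y` at the `n + 1` nodes `τ`. -/
noncomputable def richardson {n : ℕ} (τ y : Fin (n + 1) → ℝ) : ℝ :=
  (Lagrange.interpolate Finset.univ τ y).eval 0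

/-! ### Shots -/

/-- The law of a single measurement of the observable `O` in the state `ρ`: the outcome is the
eigenvalue `λᵢ` with probability `⟨vᵢ, ρ vᵢ⟩`, for an orthonormal eigenbasis `vᵢ` of `O`. -/
noncomputable def shotLaw {d : ℕ} {O : Op d} (hO : O.IsHermitian) (ρ : Op d) :
    MeasureTheory.Measure ℝ :=
  ∑ i : Fin d,
    ENNReal.ofReal
      (dotProduct (star ⇑(hO.eigenvectorBasis i)) (ρ.mulVec ⇑(hO.eigenvectorBasis i))).re •
      MeasureTheory.Measure.dirac (hO.eigenvalues i)

/-- The law of the whole experiment: at each of the `n + 1` nodes the simulated state is prepared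
and `O` is measured `N` times, all `(n + 1) N` shots being independent. -/
noncomputable def experimentLaw {d J : ℕ} (H : Op d) (L : Fin J → Op d) (T : ℝ) (ρ₀ : Op d)
    {O : Op d} (hO : O.IsHermitian) (a : ℝ) (n N : ℕ) :
    MeasureTheory.Measure (Fin (n + 1) × Fin N → ℝ) :=
  MeasureTheory.Measure.pi fun p => shotLaw hO (simulatedState H L T ρ₀ (stepCount a n p.1))

/-- The extrapolated estimate `p_n(0)` computed from the recorded shots: the value at each node is
the empirical mean of its `N` shots. -/
noncomputable def extrapolatedEstimate (a : ℝ) (n N : ℕ) (ω : Fin (n + 1) × Fin N → ℝ) : ℝ :=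
  richardson (node a n) fun j => (∑ s : Fin N, ω (j, s)) / (N : ℝ)

/-!
The estimator is `∑ⱼ wⱼ mⱼ`, where `mⱼ` is the empirical mean at the node `τⱼ` and `wⱼ` is the value
at `0` of the `j`-th Lagrange basis polynomial (`richardson_eq_sum`). Its error splits into a bias
and a statistical fluctuation, and both are controlled by the weights `wⱼ`.

*Weights.* At exact Chebyshev nodes `|wⱼ| = cot (θⱼ / 2) / (n + 1) = O(1 / (j + 1))`. The
reciprocals of the Chebyshev nodes are separated by `(i - j)² / (a (n + 1)²)`, which is at least
`2 (i - j)²` when `a (n + 1)² ≤ 1 / 2`. Rounding the reciprocals up to integers moves them by less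
than `1`, so it changes the `j`-th weight at most by the factor `exp (∑ᵢ (a + 1 / (i - j)²)) ≤ e⁵`
(`abs_extrapolationWeight_node_le`). Hence `∑ wⱼ²` is bounded by an absolute constant, and the
perturbed nodes remain distinct and ordered.

*Bias.* In the Heisenberg picture one step with `τ = x²` is `F(x) X = ⟨0| e^{iH(x)} (1 ⊗ X)
e^{-iH(x)} |0⟩` with `H(x) = x² H₀ + x H₁`, which is entire in `x`. Conjugation with the parity of
the ancilla turns `x` into `-x` and leaves `1 ⊗ X` and `|0⟩` alone, so `F` is even; moreover
`F(x) = 1 + x² A + O(x⁴)`, where `A` is the adjoint of the Lindblad generator, and `‖F(x)‖ ≤ 1` for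
real `x`. The effective generator `S(x) = x⁻² log F(x)` is therefore even and analytic near `0`,
with `S(0) = A` and `‖S(x) - A‖ = O(Λ² |x|²)`, and `exp S(1 / √k) = F(1 / √k) ^ k` is exactly the
simulated evolution. Since `A` generates contractions, `‖exp S(x)‖ ≤ exp ‖S(x) - A‖ ≤ e` on a disc
`|x|² ≤ const / Λ²` (`norm_exp_effectiveGenerator_le`); the point is that the bound does not grow
with `Λ`. So `f(τ)` extends to an even analytic function of `√τ`, that is, to an analytic function
of `τ`, bounded on `|τ| ≤ const / Λ²` (`exists_taylor_simulated`). After rescaling time, `Λ = l T`.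
As `a ≪ (l T)⁻²`, the Taylor remainders of `f` on `[0, a]` are smaller than `e^{-2(n+1)}` up to a
constant, and extrapolation is exact on the Taylor polynomial of degree `n`, so that the bias is
`O(e^{-n})` (`abs_bias_le`).

*Fluctuation.* Hoeffding's inequality for a weighted sum of independent bounded variables, together
with the bound on `∑ wⱼ²` (`experiment_accuracy`).

*Choice of the interval.* The condition `a (n + 1)² ≤ 1 / 2` holds either by the lower bound on `T`
(when `n` is of order `log (1 / ε)`) or by the assumption `2 a n² log n < 1`
(`interval_mul_sq_le`). The depth is the reciprocal of the smallest node, which is of order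
`n² / a`.
-/

/-! ### Perturbed Chebyshev nodes -/

/-- The angle `θⱼ = (2j+1)π / (2n+2)` of the `j`-th Chebyshev node. -/
noncomputable def chebAngle (n : ℕ) (j : Fin (n + 1)) : ℝ :=
  (2 * (j : ℝ) + 1) / (2 * (n : ℝ) + 2) * Real.pi

theorem chebNode_eq (a : ℝ) (n : ℕ) (j : Fin (n + 1)) :
    chebNode a n j = a / 2 * (1 - Real.cos (chebAngle n j)) := rfl

theorem chebAngle_pos (n : ℕ) (j : Fin (n + 1)) : 0 < chebAngle n j := by
  unfold chebAngle; positivity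

theorem chebAngle_lt_pi (n : ℕ) (j : Fin (n + 1)) : chebAngle n j < Real.pi := by
  have hj : (j : ℝ) ≤ n := by exact_mod_cast Nat.lt_succ_iff.mp j.2
  unfold chebAngle
  have : (2 * (j : ℝ) + 1) / (2 * (n : ℝ) + 2) < 1 := by
    rw [div_lt_one (by positivity)]; linarith
  exact mul_lt_of_lt_one_left Real.pi_pos this

theorem chebNode_lt {a : ℝ} (ha : 0 < a) (n : ℕ) (j : Fin (n + 1)) : chebNode a n j < a := by
  have h : -1 < Real.cos (chebAngle n j) := by
    rw [← Real.cos_pi]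
    exact Real.cos_lt_cos_of_nonneg_of_le_pi (chebAngle_pos n j).le le_rfl (chebAngle_lt_pi n j)
  rw [chebNode_eq]; nlinarith

/-- The nodes are quadratically separated in their index. -/
theorem chebNode_gap {a : ℝ} (ha : 0 ≤ a) {n : ℕ} {i j : Fin (n + 1)} (hij : i ≤ j) :
    a * ((j : ℝ) - i) ^ 2 / ((n : ℝ) + 1) ^ 2 ≤ chebNode a n j - chebNode a n i := by
  have hij' : (i : ℝ) ≤ j := by exact_mod_cast hij
  have hn : (0 : ℝ) < n + 1 := by positivity
  have hi := chebAngle_pos n i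
  have hj := chebAngle_lt_pi n j
  have hi' := chebAngle_lt_pi n i
  have hj' := chebAngle_pos n j
  set s := (chebAngle n i + chebAngle n j) / 2 with hs
  set t := (chebAngle n j - chebAngle n i) / 2 with ht
  have ht' : t = ((j : ℝ) - i) / (n + 1) * (Real.pi / 2) := by
    rw [ht]; unfold chebAngle; field_simp; ring
  have h0 : 0 ≤ ((j : ℝ) - i) / (n + 1) := div_nonneg (by linarith) hn.le
  have ht0 : 0 ≤ t := by rw [ht']; positivity
  have hsin : ((j : ℝ) - i) / (n + 1) ≤ Real.sin t := by
    have := Real.mul_le_sin ht0 (by linarith)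
    rw [ht'] at this ⊢
    refine le_trans (le_of_eq ?_) this
    field_simp
  have hst : Real.sin t ≤ Real.sin s := by
    have h := Real.sin_sub_sin s t
    have e1 : (s - t) / 2 = chebAngle n i / 2 := by rw [hs, ht]; ring
    have e2 : (s + t) / 2 = chebAngle n j / 2 := by rw [hs, ht]; ring
    rw [e1, e2] at h
    have h1 : 0 ≤ Real.sin (chebAngle n i / 2) :=
      Real.sin_nonneg_of_nonneg_of_le_pi (by linarith) (by linarith)
    have h2 : 0 ≤ Real.cos (chebAngle n j / 2) :=
      Real.cos_nonneg_of_neg_pi_div_two_le_of_le (by linarith) (by linarith)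
    nlinarith [mul_nonneg h1 h2]
  have key : chebNode a n j - chebNode a n i = a * (Real.sin s * Real.sin t) := by
    have h := Real.cos_sub_cos (chebAngle n i) (chebAngle n j)
    have e1 : (chebAngle n i - chebAngle n j) / 2 = -t := by rw [ht]; ring
    rw [e1, Real.sin_neg, ← hs] at h
    rw [chebNode_eq, chebNode_eq]
    linear_combination (a / 2) * h
  rw [key, mul_div_assoc, ← div_pow]
  refine mul_le_mul_of_nonneg_left ?_ ha
  nlinarith

theorem chebNode_strictMono {a : ℝ} (ha : 0 < a) (n : ℕ) : StrictMono (chebNode a n) := by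
  intro i j hij
  have h := chebNode_gap ha.le hij.le
  have hij' : (i : ℝ) < j := by exact_mod_cast hij
  have : 0 < a * ((j : ℝ) - i) ^ 2 / ((n : ℝ) + 1) ^ 2 := by
    have : 0 < (j : ℝ) - i := by linarith
    positivity
  linarith

/-- The smallest node, by the half-angle formula. -/
theorem chebNode_zero_eq (a : ℝ) (n : ℕ) :
    chebNode a n 0 = a * Real.sin (Real.pi / (4 * (n + 1))) ^ 2 := by
  have h : chebAngle n 0 = 2 * (Real.pi / (4 * (n + 1))) := by
    unfold chebAngle
    have : (n : ℝ) + 1 ≠ 0 := by positivity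
    simp only [Fin.val_zero, Nat.cast_zero]
    field_simp; ring
  rw [chebNode_eq, h, Real.cos_two_mul, Real.sin_sq]; ring

theorem chebNode_zero_ge {a : ℝ} (ha : 0 ≤ a) (n : ℕ) :
    a / (4 * ((n : ℝ) + 1) ^ 2) ≤ chebNode a n 0 := by
  have hn : (0 : ℝ) < n + 1 := by positivity
  have hle : Real.pi / (4 * (n + 1)) ≤ Real.pi / 2 :=
    div_le_div_of_nonneg_left Real.pi_pos.le two_pos (by
      have : (0 : ℝ) ≤ n := by positivity
      linarith)
  have h := Real.mul_le_sin (by positivity) hle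
  have e : 2 / Real.pi * (Real.pi / (4 * ((n : ℝ) + 1))) = 1 / (2 * (n + 1)) := by
    field_simp; norm_num
  rw [e] at h
  rw [chebNode_zero_eq]
  have h2 : (1 / (2 * ((n : ℝ) + 1))) ^ 2 ≤ Real.sin (Real.pi / (4 * (n + 1))) ^ 2 :=
    pow_le_pow_left₀ (by positivity) h 2
  calc a / (4 * ((n : ℝ) + 1) ^ 2) = a * (1 / (2 * ((n : ℝ) + 1))) ^ 2 := by field_simp; norm_num
    _ ≤ _ := mul_le_mul_of_nonneg_left h2 ha

theorem chebNode_zero_le {a : ℝ} (ha : 0 ≤ a) (n : ℕ) :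
    chebNode a n 0 ≤ a / ((n : ℝ) + 1) ^ 2 := by
  have hn : (0 : ℝ) < n + 1 := by positivity
  have hp : (0 : ℝ) ≤ Real.pi / (4 * (n + 1)) := by positivity
  have h := Real.sin_le hp
  have hle : Real.pi / (4 * (n + 1)) ≤ Real.pi :=
    div_le_self Real.pi_pos.le (by
      have : (0 : ℝ) ≤ n := by positivity
      linarith)
  have h0 := Real.sin_nonneg_of_nonneg_of_le_pi hp hle
  have h1 : Real.sin (Real.pi / (4 * (n + 1))) ≤ 1 / (n + 1) := by
    refine h.trans ?_
    rw [div_le_div_iff₀ (by positivity) hn]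
    nlinarith [Real.pi_lt_four]
  rw [chebNode_zero_eq]
  calc _ ≤ a * (1 / ((n : ℝ) + 1)) ^ 2 := mul_le_mul_of_nonneg_left (pow_le_pow_left₀ h0 h1 2) ha
    _ = _ := by field_simp

theorem chebNode_pos {a : ℝ} (ha : 0 < a) (n : ℕ) (j : Fin (n + 1)) : 0 < chebNode a n j := by
  have h0 : 0 < chebNode a n 0 := lt_of_lt_of_le (by positivity) (chebNode_zero_ge ha.le n)
  exact h0.trans_le ((chebNode_strictMono ha n).monotone (Fin.zero_le j))

/-- The reciprocals of the nodes are separated by `(j - i)² / (a (n+1)²)`. -/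
theorem inv_chebNode_gap {a : ℝ} (ha : 0 < a) {n : ℕ} {i j : Fin (n + 1)} (hij : i ≤ j) :
    ((j : ℝ) - i) ^ 2 / (a * ((n : ℝ) + 1) ^ 2) ≤ 1 / chebNode a n i - 1 / chebNode a n j := by
  have hi := chebNode_pos ha n i
  have hj := chebNode_pos ha n j
  have hi' := chebNode_lt ha n i
  have hj' := chebNode_lt ha n j
  have hg := chebNode_gap ha.le hij
  have hn : (0 : ℝ) < n + 1 := by positivity
  have e : 1 / chebNode a n i - 1 / chebNode a n j =
      (chebNode a n j - chebNode a n i) / (chebNode a n i * chebNode a n j) := by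
    field_simp
  rw [e]
  calc ((j : ℝ) - i) ^ 2 / (a * ((n : ℝ) + 1) ^ 2)
      = (a * ((j : ℝ) - i) ^ 2 / ((n : ℝ) + 1) ^ 2) / (a * a) := by field_simp
    _ ≤ (chebNode a n j - chebNode a n i) / (a * a) := by gcongr
    _ ≤ _ := by
        have : 0 ≤ a * ((j : ℝ) - i) ^ 2 / ((n : ℝ) + 1) ^ 2 := by positivity
        apply div_le_div_of_nonneg_left (by linarith) (by positivity)
        gcongr

/-- The separation of the reciprocals exceeds the rounding error, at most `1`, that is made in
passing to step counts. -/
theorem two_mul_sq_le_inv_chebNode_gap {a : ℝ} (ha : 0 < a) {n : ℕ}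
    (hq : a * ((n : ℝ) + 1) ^ 2 ≤ 1 / 2) {i j : Fin (n + 1)} (hij : i ≤ j) :
    2 * ((j : ℝ) - i) ^ 2 ≤ 1 / chebNode a n i - 1 / chebNode a n j := by
  refine le_trans ?_ (inv_chebNode_gap ha hij)
  rw [le_div_iff₀ (by positivity)]
  nlinarith [sq_nonneg ((j : ℝ) - i)]

theorem le_stepCount (a : ℝ) (n : ℕ) (j : Fin (n + 1)) :
    1 / chebNode a n j ≤ stepCount a n j := Nat.le_ceil _

theorem stepCount_lt {a : ℝ} (ha : 0 < a) (n : ℕ) (j : Fin (n + 1)) :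
    (stepCount a n j : ℝ) < 1 / chebNode a n j + 1 :=
  Nat.ceil_lt_add_one (one_div_pos.mpr (chebNode_pos ha n j)).le

theorem stepCount_pos {a : ℝ} (ha : 0 < a) (n : ℕ) (j : Fin (n + 1)) : 0 < stepCount a n j :=
  Nat.ceil_pos.mpr (one_div_pos.mpr (chebNode_pos ha n j))

theorem node_pos {a : ℝ} (ha : 0 < a) (n : ℕ) (j : Fin (n + 1)) : 0 < node a n j :=
  one_div_pos.mpr (by exact_mod_cast stepCount_pos ha n j)

theorem node_lt {a : ℝ} (ha : 0 < a) (n : ℕ) (j : Fin (n + 1)) : node a n j < a := by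
  refine lt_of_le_of_lt ?_ (chebNode_lt ha n j)
  have := chebNode_pos ha n j
  unfold node
  rw [one_div_le (by exact_mod_cast stepCount_pos ha n j) this]
  exact le_stepCount a n j

theorem stepCount_strictAnti {a : ℝ} (ha : 0 < a) {n : ℕ} (hq : a * ((n : ℝ) + 1) ^ 2 ≤ 1 / 2) :
    StrictAnti (stepCount a n) := by
  intro i j hij
  have h := two_mul_sq_le_inv_chebNode_gap ha hq hij.le
  have h1 := le_stepCount a n i
  have h2 := stepCount_lt ha n j
  have hij' : (i : ℝ) + 1 ≤ j := by exact_mod_cast hij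
  have : (stepCount a n j : ℝ) < stepCount a n i := by nlinarith
  exact_mod_cast this

theorem node_strictMono {a : ℝ} (ha : 0 < a) {n : ℕ} (hq : a * ((n : ℝ) + 1) ^ 2 ≤ 1 / 2) :
    StrictMono (node a n) := by
  intro i j hij
  exact one_div_lt_one_div_of_lt (by exact_mod_cast stepCount_pos ha n j)
    (by exact_mod_cast stepCount_strictAnti ha hq hij)

theorem maxDepth_eq {a : ℝ} (ha : 0 < a) {n : ℕ} (hq : a * ((n : ℝ) + 1) ^ 2 ≤ 1 / 2) :
    maxDepth a n = stepCount a n 0 :=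
  le_antisymm
    (Finset.sup_le fun j _ => (stepCount_strictAnti ha hq).antitone (Fin.zero_le j))
    (Finset.le_sup (f := stepCount a n) (Finset.mem_univ 0))

/-! ### The extrapolation weights -/

/-- The weight of the `j`-th node in Richardson extrapolation: the `j`-th Lagrange basis
polynomial at `0`. -/
noncomputable def extrapolationWeight {n : ℕ} (τ : Fin (n + 1) → ℝ) (j : Fin (n + 1)) : ℝ :=
  (Lagrange.basis Finset.univ τ j).eval 0

theorem richardson_eq_sum {n : ℕ} (τ y : Fin (n + 1) → ℝ) :
    richardson τ y = ∑ j, extrapolationWeight τ j * y j := by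
  simp [richardson, extrapolationWeight, Lagrange.interpolate_apply, Polynomial.eval_finsetSum,
    mul_comm]

theorem extrapolationWeight_eq_prod {n : ℕ} (τ : Fin (n + 1) → ℝ) (j : Fin (n + 1)) :
    extrapolationWeight τ j = ∏ i ∈ Finset.univ.erase j, (τ i / (τ i - τ j)) := by
  rw [extrapolationWeight, Lagrange.basis, Polynomial.eval_prod]
  refine Finset.prod_congr rfl fun i _ => ?_
  simp only [Lagrange.basisDivisor, Polynomial.eval_mul, Polynomial.eval_C, Polynomial.eval_sub,
    Polynomial.eval_X, zero_sub]
  rw [← neg_sub (τ i) (τ j), inv_neg, neg_mul_neg, div_eq_inv_mul]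

/-- Extrapolation to `0` is exact on polynomials of degree at most `n`. -/
theorem sum_extrapolationWeight_mul_pow {n : ℕ} {τ : Fin (n + 1) → ℝ}
    (hτ : Function.Injective τ) {m : ℕ} (hm : m ≤ n) :
    ∑ j, extrapolationWeight τ j * τ j ^ m = 0 ^ m := by
  have h := Lagrange.eq_interpolate (s := Finset.univ) (v := τ)
    (f := (Polynomial.X : Polynomial ℝ) ^ m)
    hτ.injOn (by
      rw [Polynomial.degree_X_pow]
      rw [Finset.card_univ, Fintype.card_fin]
      exact_mod_cast Nat.lt_succ_of_le hm)
  have h2 := congrArg (Polynomial.eval 0) h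
  rw [Polynomial.eval_pow, Polynomial.eval_X] at h2
  rw [h2, ← richardson, richardson_eq_sum]
  simp

theorem sum_inv_sq_le (n : ℕ) : ∑ m ∈ Finset.range n, 1 / ((m : ℝ) + 1) ^ 2 ≤ 2 := by
  have h : ∀ n : ℕ, ∑ m ∈ Finset.range n, 1 / ((m : ℝ) + 1) ^ 2 ≤ 2 - 2 / ((n : ℝ) + 1) := by
    intro n
    induction n with
    | zero => simp
    | succ k ih =>
      rw [Finset.sum_range_succ]
      have : 1 / ((k : ℝ) + 1) ^ 2 ≤ 2 / ((k : ℝ) + 1) - 2 / ((k : ℝ) + 1 + 1) := by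
        rw [div_sub_div _ _ (by positivity) (by positivity),
          div_le_div_iff₀ (by positivity) (by positivity)]
        have : (0 : ℝ) ≤ k := by positivity
        nlinarith [mul_nonneg this this, mul_nonneg this (mul_nonneg this this)]
      push_cast
      linarith
  have := h n
  have : (0 : ℝ) ≤ 2 / ((n : ℝ) + 1) := by positivity
  linarith [h n]

theorem sum_inv_sq_sub_le {n : ℕ} (j : Fin (n + 1)) :
    ∑ i ∈ Finset.univ.erase j, 1 / ((i : ℝ) - j) ^ 2 ≤ 4 := by
  -- the term `i = j` is `1 / 0 = 0`
  have h0 : ∑ i ∈ Finset.univ.erase j, 1 / ((i : ℝ) - j) ^ 2 =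
      ∑ i : Fin (n + 1), 1 / ((i : ℝ) - j) ^ 2 := by
    rw [← Finset.add_sum_erase _ _ (Finset.mem_univ j)]; simp
  rw [h0, Finset.sum_fin_eq_sum_range]
  obtain ⟨k, hk⟩ := Nat.exists_eq_add_of_le (Nat.lt_succ_iff.mp j.2)
  have h1 : ∑ i ∈ Finset.range (n + 1),
      (if h : i < n + 1 then 1 / (((⟨i, h⟩ : Fin (n + 1)) : ℝ) - j) ^ 2 else 0) =
      ∑ i ∈ Finset.range ((j : ℕ) + (1 + k)), 1 / ((i : ℝ) - (j : ℕ)) ^ 2 := by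
    have : n + 1 = (j : ℕ) + (1 + k) := by omega
    rw [← this]
    refine Finset.sum_congr rfl fun i hi => ?_
    rw [dif_pos (Finset.mem_range.mp hi)]
  rw [h1, Finset.sum_range_add, Finset.sum_range_add]
  have h2 : ∑ i ∈ Finset.range (j : ℕ), 1 / ((i : ℝ) - (j : ℕ)) ^ 2 ≤ 2 := by
    rw [← Finset.sum_range_reflect]
    refine le_trans (le_of_eq (Finset.sum_congr rfl fun i hi => ?_)) (sum_inv_sq_le (j : ℕ))
    have hi' := Finset.mem_range.mp hi
    rw [Nat.cast_sub (by omega), Nat.cast_sub (by omega)]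
    congr 1; push_cast; ring
  have h3 := sum_inv_sq_le k
  simp only [Finset.range_one, Finset.sum_singleton]
  have h4 : ∑ i ∈ Finset.range k, 1 / ((((j : ℕ) + (1 + i) : ℕ) : ℝ) - (j : ℕ)) ^ 2 =
      ∑ m ∈ Finset.range k, 1 / ((m : ℝ) + 1) ^ 2 := by
    refine Finset.sum_congr rfl fun i _ => ?_
    congr 1; push_cast; ring
  rw [h4]
  have h5 : 1 / ((((j : ℕ) + 0 : ℕ) : ℝ) - (j : ℕ)) ^ 2 = 0 := by simp
  rw [h5]
  linarith

open Polynomial in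
/-- The Chebyshev polynomial `T_{n+1}` factors over its roots `cos θⱼ`. -/
theorem chebyshevT_eq_C_mul_nodal (n : ℕ) :
    Chebyshev.T ℝ ((n + 1 : ℕ) : ℤ) =
      C (Chebyshev.T ℝ ((n + 1 : ℕ) : ℤ)).leadingCoeff *
        Lagrange.nodal Finset.univ fun i : Fin (n + 1) => Real.cos (chebAngle n i) := by
  have hinj := (Finset.range (n + 1)).nodup_map_iff_injOn.mp (Chebyshev.roots_T_real_nodup (n + 1))
  have hr := Chebyshev.roots_T_real (n + 1)
  have h := C_leadingCoeff_mul_prod_multiset_X_sub_C (p := Chebyshev.T ℝ ((n + 1 : ℕ) : ℤ)) (by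
    rw [hr]
    simp only [Finset.card_val]
    rw [Finset.card_image_of_injOn hinj, Finset.card_range, Chebyshev.natDegree_T,
      Int.natAbs_natCast])
  conv_lhs => rw [← h]
  congr 1
  rw [hr, Lagrange.nodal_eq]
  change ∏ x ∈ Finset.image _ _, (X - C x) = _
  rw [Finset.prod_image hinj, Finset.prod_range]
  refine Finset.prod_congr rfl fun i _ => ?_
  congr 3
  unfold chebAngle
  push_cast
  ring

theorem sin_mul_le_one_sub_cos {x : ℝ} (h0 : 0 < x) (h1 : x < Real.pi) :
    x * Real.sin x ≤ 2 * (1 - Real.cos x) := by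
  obtain ⟨u, rfl⟩ : ∃ u, x = 2 * u := ⟨x / 2, by ring⟩
  have hc : 0 < Real.cos u := Real.cos_pos_of_mem_Ioo ⟨by linarith, by linarith⟩
  have ht := Real.lt_tan (x := u) (by linarith) (by linarith)
  rw [Real.tan_eq_sin_div_cos, lt_div_iff₀ hc] at ht
  have hs : 0 < Real.sin u := Real.sin_pos_of_pos_of_lt_pi (by linarith) (by linarith)
  rw [Real.sin_two_mul, Real.cos_two_mul]
  nlinarith [Real.sin_sq_add_cos_sq u]

open Polynomial in
/-- The weights at exact Chebyshev nodes, `|wⱼ| = cot(θⱼ/2)/(n+1)`, decay like `1/(j+1)`. -/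
theorem abs_prod_chebNode_le {a : ℝ} (ha : 0 < a) {n : ℕ} (j : Fin (n + 1)) :
    |∏ i ∈ Finset.univ.erase j, (chebNode a n i / (chebNode a n i - chebNode a n j))| ≤
      2 / ((j : ℝ) + 1) := by
  set v : Fin (n + 1) → ℝ := fun i => Real.cos (chebAngle n i) with hv
  set lc := (Chebyshev.T ℝ ((n + 1 : ℕ) : ℤ)).leadingCoeff with hlc
  have hT := chebyshevT_eq_C_mul_nodal n
  rw [← hlc, ← hv] at hT
  have hj0 := chebAngle_pos n j
  have hj1 := chebAngle_lt_pi n j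
  have hsin : 0 < Real.sin (chebAngle n j) := Real.sin_pos_of_pos_of_lt_pi hj0 hj1
  have hn : (0 : ℝ) < n + 1 := by positivity
  -- `T'(xⱼ) sin θⱼ = (n+1) sin((n+1)θⱼ) = ± (n+1)`
  have hder : |lc * (Lagrange.nodal (Finset.univ.erase j) v).eval (v j)| *
      Real.sin (chebAngle n j) = n + 1 := by
    rw [← Lagrange.eval_nodal_derivative_eval_node_eq (Finset.mem_univ j)]
    have h1 : lc * eval (v j) (derivative (Lagrange.nodal Finset.univ v)) =
        eval (v j) (derivative (Chebyshev.T ℝ ((n + 1 : ℕ) : ℤ))) := by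
      rw [hT, derivative_C_mul, eval_mul, eval_C]
    rw [h1, Chebyshev.T_derivative_eq_U, ← abs_of_pos hsin, ← abs_mul, eval_mul, mul_assoc]
    have h2 := Chebyshev.U_real_cos (chebAngle n j) (((n + 1 : ℕ) : ℤ) - 1)
    rw [hv]
    simp only
    rw [h2]
    have h3 : ((((n + 1 : ℕ) : ℤ) - 1 : ℤ) + 1 : ℝ) * chebAngle n j =
        j * Real.pi + Real.pi / 2 := by
      unfold chebAngle; push_cast; field_simp; ring
    have h4 := Real.abs_cos_int_mul_pi (j : ℕ)
    rw [Int.cast_natCast] at h4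
    rw [h3, Real.sin_add_pi_div_two, abs_mul, h4, mul_one]
    simp
    positivity
  have hval : lc * (Lagrange.nodal (Finset.univ.erase j) v).eval 1 * (1 - v j) = 1 := by
    have h1 := congrArg (eval 1) hT
    rw [Chebyshev.T_eval_one, eval_mul, eval_C,
      Lagrange.nodal_eq_mul_nodal_erase (Finset.mem_univ j), eval_mul] at h1
    simp only [eval_sub, eval_X, eval_C] at h1
    linarith
  have hprod : ∏ i ∈ Finset.univ.erase j, (chebNode a n i / (chebNode a n i - chebNode a n j)) =
      (lc * (Lagrange.nodal (Finset.univ.erase j) v).eval 1) /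
        (lc * (Lagrange.nodal (Finset.univ.erase j) v).eval (v j)) := by
    have hlc0 : lc ≠ 0 := by
      intro h; rw [h] at hval; simp at hval
    rw [mul_div_mul_left _ _ hlc0, Lagrange.eval_nodal, Lagrange.eval_nodal,
      ← Finset.prod_div_distrib]
    refine Finset.prod_congr rfl fun i _ => ?_
    have e : chebNode a n i - chebNode a n j = a / 2 * (v j - v i) := by
      rw [chebNode_eq, chebNode_eq, hv]; ring
    rw [e, chebNode_eq, mul_div_mul_left _ _ (by positivity)]
  have hb := sin_mul_le_one_sub_cos hj0 hj1
  have hpos : 0 < 1 - v j := by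
    have := mul_pos hj0 hsin
    have hvj : v j = Real.cos (chebAngle n j) := rfl
    linarith
  have hvj : v j = Real.cos (chebAngle n j) := rfl
  rw [hprod, abs_div]
  have hD : |lc * (Lagrange.nodal (Finset.univ.erase j) v).eval (v j)| =
      (n + 1) / Real.sin (chebAngle n j) := by rw [eq_div_iff hsin.ne', hder]
  have hN : |lc * (Lagrange.nodal (Finset.univ.erase j) v).eval 1| = 1 / (1 - v j) := by
    have h := congrArg abs hval
    rwa [abs_mul, abs_of_pos hpos, abs_one, ← eq_div_iff hpos.ne'] at h
  rw [hD, hN, div_div_div_eq, one_mul]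
  calc Real.sin (chebAngle n j) / ((1 - v j) * (n + 1))
      ≤ 2 / (chebAngle n j * (n + 1)) := by
        rw [div_le_div_iff₀ (by positivity) (by positivity), hvj]
        nlinarith
    _ ≤ 2 / ((j : ℝ) + 1) := by
        apply div_le_div_of_nonneg_left (by norm_num) (by positivity)
        have : chebAngle n j * (n + 1) = (2 * (j : ℝ) + 1) / 2 * Real.pi := by
          unfold chebAngle; field_simp
        rw [this]
        nlinarith [Real.pi_gt_three, (Nat.cast_nonneg (j : ℕ) : (0 : ℝ) ≤ (j : ℕ))]

/-- Rounding the reciprocals `x`, `y` of two nodes up to `x'`, `y'` changes their Lagrange factor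
by little when they are far apart. -/
theorem abs_factor_le {x y x' y' r : ℝ} (hx : 0 < x) (hx1 : x ≤ x') (hx2 : x' ≤ x + 1)
    (hy1 : y ≤ y') (hy2 : y' ≤ y + 1) (hr : 1 ≤ r) (hxy : 2 * r ≤ |x - y|) :
    |x' / (x' - y')| ≤ |x / (x - y)| * Real.exp (1 / x + 1 / r) := by
  have hr0 : 0 < r := by linarith
  have h1 : |x - y| - 1 ≤ |x' - y'| := by
    have : |x - y| ≤ |x' - y'| + 1 := by
      have e : x - y = (x' - y') + ((x - x') - (y - y')) := by ring
      rw [e]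
      refine (abs_add_le _ _).trans ?_
      gcongr
      rw [abs_le]; constructor <;> linarith
    linarith
  have hpos : 0 < |x - y| := by linarith
  have hpos' : 0 < |x' - y'| := by linarith
  rw [abs_div, abs_div, abs_of_pos hx, abs_of_pos (hx.trans_le hx1), Real.exp_add]
  have e1 : x' ≤ x * Real.exp (1 / x) := by
    have := Real.add_one_le_exp (1 / x)
    calc x' ≤ x * (1 / x + 1) := by field_simp; linarith
      _ ≤ _ := by gcongr
  have e2 : |x - y| ≤ |x' - y'| * Real.exp (1 / r) := by
    have := Real.add_one_le_exp (1 / r)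
    have h3 : |x' - y'| ≥ r := by linarith
    calc |x - y| ≤ |x' - y'| + |x' - y'| * (1 / r) := by
          have : 1 ≤ |x' - y'| * (1 / r) := by
            rw [mul_one_div, le_div_iff₀ hr0]; linarith
          linarith
      _ = |x' - y'| * (1 / r + 1) := by ring
      _ ≤ _ := by gcongr
  rw [div_mul_eq_mul_div, div_le_div_iff₀ hpos' hpos]
  calc x' * |x - y| ≤ (x * Real.exp (1 / x)) * (|x' - y'| * Real.exp (1 / r)) := by gcongr
    _ = _ := by ring

/-- The weights at the perturbed Chebyshev nodes still decay like `1/(j+1)`. -/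
theorem abs_extrapolationWeight_node_le {a : ℝ} (ha : 0 < a) {n : ℕ}
    (hq : a * ((n : ℝ) + 1) ^ 2 ≤ 1 / 2) (j : Fin (n + 1)) :
    |extrapolationWeight (node a n) j| ≤ 2 * Real.exp 5 / ((j : ℝ) + 1) := by
  have hfac : ∀ i ∈ Finset.univ.erase j, |node a n i / (node a n i - node a n j)| ≤
      |chebNode a n i / (chebNode a n i - chebNode a n j)| *
        Real.exp (a + 1 / ((i : ℝ) - j) ^ 2) := by
    intro i hi
    have hne : i ≠ j := Finset.ne_of_mem_erase hi
    have hξi := chebNode_pos ha n i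
    have hξj := chebNode_pos ha n j
    have hki : (0 : ℝ) < stepCount a n i := by exact_mod_cast stepCount_pos ha n i
    have hkj : (0 : ℝ) < stepCount a n j := by exact_mod_cast stepCount_pos ha n j
    have hinv : ∀ u v : ℝ, 0 < u → 0 < v → 1 / u / (1 / u - 1 / v) = v / (v - u) := by
      intro u v hu hv
      by_cases h : u = v
      · simp [h]
      · have : v - u ≠ 0 := sub_ne_zero.mpr (Ne.symm h)
        have : 1 / u - 1 / v = (v - u) / (u * v) := by field_simp
        rw [this]; field_simp
    have e2 : chebNode a n i / (chebNode a n i - chebNode a n j) =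
        1 / chebNode a n j / (1 / chebNode a n j - 1 / chebNode a n i) :=
      (hinv _ _ hξj hξi).symm
    unfold node
    rw [hinv _ _ hki hkj, e2]
    have hsq : (1 : ℝ) ≤ ((i : ℝ) - j) ^ 2 := by
      have h1 : (1 : ℤ) ≤ |(i : ℤ) - j| := by
        apply Int.one_le_abs
        intro h
        exact hne (Fin.ext (by omega))
      have h2 : (1 : ℤ) ≤ ((i : ℤ) - j) ^ 2 := by
        rw [← sq_abs]; nlinarith
      exact_mod_cast h2
    have hgap : 2 * ((i : ℝ) - j) ^ 2 ≤ |1 / chebNode a n j - 1 / chebNode a n i| := by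
      rcases le_total i j with h | h
      · have := two_mul_sq_le_inv_chebNode_gap ha hq h
        rw [abs_sub_comm]
        refine le_trans (le_of_eq ?_) (this.trans (le_abs_self _))
        ring
      · exact (two_mul_sq_le_inv_chebNode_gap ha hq h).trans (le_abs_self _)
    refine (abs_factor_le (one_div_pos.mpr hξj) (le_stepCount a n j) (stepCount_lt ha n j).le
      (le_stepCount a n i) (stepCount_lt ha n i).le hsq hgap).trans ?_
    gcongr
    rw [one_div_one_div]
    exact (chebNode_lt ha n j).le
  rw [extrapolationWeight_eq_prod, Finset.abs_prod]
  calc _ ≤ ∏ i ∈ Finset.univ.erase j, (|chebNode a n i / (chebNode a n i - chebNode a n j)| *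
        Real.exp (a + 1 / ((i : ℝ) - j) ^ 2)) :=
        Finset.prod_le_prod (fun _ _ => abs_nonneg _) hfac
    _ = |∏ i ∈ Finset.univ.erase j, (chebNode a n i / (chebNode a n i - chebNode a n j))| *
        Real.exp (∑ i ∈ Finset.univ.erase j, (a + 1 / ((i : ℝ) - j) ^ 2)) := by
        rw [Finset.prod_mul_distrib, Finset.abs_prod, Real.exp_sum]
    _ ≤ 2 / ((j : ℝ) + 1) * Real.exp 5 := by
        gcongr
        · exact abs_prod_chebNode_le ha j
        · rw [Finset.sum_add_distrib, Finset.sum_const,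
            Finset.card_erase_of_mem (Finset.mem_univ j), Finset.card_univ,
            Fintype.card_fin, Nat.add_sub_cancel, nsmul_eq_mul]
          have h1 := sum_inv_sq_sub_le j
          have h2 : (n : ℝ) * a ≤ 1 := by
            have : (0 : ℝ) ≤ n := by positivity
            nlinarith [mul_nonneg ha.le this, mul_nonneg (mul_nonneg ha.le this) this]
          linarith
    _ = _ := by ring

/-- The variance of the extrapolated estimate is larger than that of a single node only by an
absolute constant. -/
theorem sum_sq_extrapolationWeight_node_le {a : ℝ} (ha : 0 < a) {n : ℕ}
    (hq : a * ((n : ℝ) + 1) ^ 2 ≤ 1 / 2) :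
    ∑ j, extrapolationWeight (node a n) j ^ 2 ≤ 8 * Real.exp 5 ^ 2 := by
  calc ∑ j, extrapolationWeight (node a n) j ^ 2
      ≤ ∑ j : Fin (n + 1), (2 * Real.exp 5) ^ 2 * (1 / (((j : ℕ) : ℝ) + 1) ^ 2) := by
        refine Finset.sum_le_sum fun j _ => ?_
        rw [← sq_abs, mul_one_div, ← div_pow]
        exact pow_le_pow_left₀ (abs_nonneg _) (abs_extrapolationWeight_node_le ha hq j) 2
    _ = (2 * Real.exp 5) ^ 2 * ∑ m ∈ Finset.range (n + 1), 1 / ((m : ℝ) + 1) ^ 2 := by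
        rw [← Finset.mul_sum, Fin.sum_univ_eq_sum_range (fun m => 1 / ((m : ℝ) + 1) ^ 2)]
    _ ≤ (2 * Real.exp 5) ^ 2 * 2 := by gcongr; exact sum_inv_sq_le _
    _ = _ := by ring

theorem sum_abs_extrapolationWeight_node_le {a : ℝ} (ha : 0 < a) {n : ℕ}
    (hq : a * ((n : ℝ) + 1) ^ 2 ≤ 1 / 2) :
    ∑ j, |extrapolationWeight (node a n) j| ≤ 2 * Real.exp 5 * ((n : ℝ) + 1) := by
  calc ∑ j, |extrapolationWeight (node a n) j| ≤ ∑ _j : Fin (n + 1), 2 * Real.exp 5 := by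
        refine Finset.sum_le_sum fun j _ => ?_
        exact (abs_extrapolationWeight_node_le ha hq j).trans
          (div_le_self (by positivity) (by simp))
    _ = _ := by simp; ring

/-! ### Taylor expansion of even functions -/

/-- Taylor expansion of an even analytic function in powers of `x²`, with geometric remainder. -/
theorem exists_even_taylor {E : Type*} [NormedAddCommGroup E] [NormedSpace ℂ E] [CompleteSpace E]
    {g : ℂ → E} {r C : ℝ} (hr : 0 < r) (hg : DiffContOnCl ℂ g (Metric.ball 0 r))
    (hC : ∀ z ∈ Metric.sphere (0 : ℂ) r, ‖g z‖ ≤ C) (heven : ∀ z, g (-z) = g z) :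
    ∃ c : ℕ → E, c 0 = g 0 ∧ ∀ (n : ℕ) (x : ℂ), ‖x‖ < r →
      ‖g x - ∑ m ∈ Finset.range n, x ^ (2 * m) • c m‖ ≤
        C * ((‖x‖ / r) ^ 2) ^ n / (1 - (‖x‖ / r) ^ 2) := by
  refine ⟨fun m => (((2 * m).factorial : ℂ))⁻¹ • iteratedDeriv (2 * m) g 0, by simp, ?_⟩
  intro n x hx
  have hT : ∀ z : ℂ, ‖z‖ < r →
      HasSum (fun k : ℕ => (k.factorial : ℂ)⁻¹ • z ^ k • iteratedDeriv k g 0) (g z) := by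
    intro z hz
    have := Complex.hasSum_taylorSeries_on_ball hg.differentiableOn
      (z := z) (by simpa using hz)
    simpa using this
  have h1 := hT x hx
  have h2 := hT (-x) (by simpa using hx)
  rw [heven] at h2
  have h3 := (h1.add h2).const_smul (2 : ℂ)⁻¹
  have h4 : (2 : ℂ)⁻¹ • (g x + g x) = g x := by rw [← two_smul ℂ (g x), smul_smul]; norm_num
  rw [h4] at h3
  have h5 : HasSum (fun m : ℕ => x ^ (2 * m) • ((((2 * m).factorial : ℂ))⁻¹ •
      iteratedDeriv (2 * m) g 0)) (g x) := by
    have hinj : Function.Injective (fun m : ℕ => 2 * m) := fun a b h => by simpa using h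
    rw [← hinj.hasSum_iff] at h3
    · refine h3.congr_fun ?_
      intro m
      simp only [Function.comp, Even.neg_pow (even_two_mul m)]
      rw [← two_smul ℂ, inv_smul_smul₀ two_ne_zero, smul_comm]
    · intro k hk
      have hodd : Odd k := by
        rw [← Nat.not_even_iff_odd]
        rintro ⟨m, rfl⟩
        exact hk ⟨m, by ring⟩
      simp [hodd.neg_pow]
  have h6 := (hasSum_nat_add_iff' n).mpr h5
  have hq0 : 0 ≤ (‖x‖ / r) ^ 2 := by positivity
  have hq1 : (‖x‖ / r) ^ 2 < 1 := by
    have : ‖x‖ / r < 1 := (div_lt_one hr).mpr hx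
    have h0 : 0 ≤ ‖x‖ / r := by positivity
    nlinarith
  have h7 := ((hasSum_geometric_of_lt_one hq0 hq1).mul_left (C * ((‖x‖ / r) ^ 2) ^ n))
  rw [← div_eq_mul_inv] at h7
  rw [← h6.tsum_eq]
  refine tsum_of_norm_bounded h7 fun m => ?_
  have hd := Complex.norm_iteratedDeriv_le_of_forall_mem_sphere_norm_le (2 * (m + n)) hr hg hC
  rw [norm_smul, norm_smul, norm_pow, norm_inv, Complex.norm_natCast]
  have hf : (0 : ℝ) < (2 * (m + n)).factorial := by exact_mod_cast Nat.factorial_pos _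
  calc ‖x‖ ^ (2 * (m + n)) * (((2 * (m + n)).factorial : ℝ)⁻¹ * ‖iteratedDeriv (2 * (m + n)) g 0‖)
      ≤ ‖x‖ ^ (2 * (m + n)) * (((2 * (m + n)).factorial : ℝ)⁻¹ *
          ((2 * (m + n)).factorial * C / r ^ (2 * (m + n)))) := by gcongr
    _ = C * (‖x‖ / r) ^ (2 * (m + n)) := by rw [div_pow]; field_simp
    _ = _ := by rw [pow_mul, pow_add]; ring

/-! ### Logarithms and exponentials in Banach algebras -/

theorem norm_log_term_le {𝔸 : Type*} [NormedRing 𝔸] [NormedAlgebra ℂ 𝔸] (Y : 𝔸) (m : ℕ) :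
    ‖((-1) ^ m / (m + 1) : ℂ) • Y ^ (m + 1)‖ ≤ ‖Y‖ ^ (m + 1) := by
  rw [norm_smul]
  have h1 : ‖((-1) ^ m / (m + 1) : ℂ)‖ ≤ 1 := by
    rw [norm_div, norm_pow, norm_neg, norm_one, one_pow]
    have : ‖(m + 1 : ℂ)‖ = (m : ℝ) + 1 := by
      exact_mod_cast Complex.norm_natCast (m + 1)
    rw [this, div_le_one (by positivity)]
    have : (0 : ℝ) ≤ m := by positivity
    linarith
  calc _ ≤ 1 * ‖Y‖ ^ (m + 1) := by
        gcongr
        exact norm_pow_le' Y (Nat.succ_pos m)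
    _ = _ := one_mul _

section BanachAlgebra

variable {𝔸 : Type*} [NormedRing 𝔸] [NormedAlgebra ℂ 𝔸] [CompleteSpace 𝔸]

theorem exp_sub_one_sub_isBigO :
    (fun X : 𝔸 => NormedSpace.exp X - 1 - X) =O[nhds 0] fun X => ‖X‖ ^ 2 := by
  have h := (NormedSpace.exp_hasFPowerSeriesOnBall (𝕂 := ℂ)
    (𝔸 := 𝔸)).hasFPowerSeriesAt.isBigO_sub_partialSum_pow 2
  refine h.congr_left fun X => ?_
  simp [FormalMultilinearSeries.partialSum, Finset.sum_range_succ, NormedSpace.expSeries_apply_eq,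
    sub_sub]

theorem exp_sub_quadratic_isBigO :
    (fun X : 𝔸 => NormedSpace.exp X - (1 + X + (2⁻¹ : ℂ) • X ^ 2)) =O[nhds 0] fun X => ‖X‖ ^ 3 := by
  have h := (NormedSpace.exp_hasFPowerSeriesOnBall (𝕂 := ℂ)
    (𝔸 := 𝔸)).hasFPowerSeriesAt.isBigO_sub_partialSum_pow 3
  refine h.congr_left fun X => ?_
  simp [FormalMultilinearSeries.partialSum, Finset.sum_range_succ, NormedSpace.expSeries_apply_eq]

/-- The chain rule for `exp ∘ k` at a point `z`, when the values of `k` near `z` commute with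
`k z`. -/
theorem HasDerivAt.exp_of_eventually_commute {k : ℂ → 𝔸} {k' : 𝔸} {z : ℂ} (hk : HasDerivAt k k' z)
    (hc : ∀ᶠ w in nhds z, Commute (k z) (k w)) :
    HasDerivAt (fun w => NormedSpace.exp (k w)) (NormedSpace.exp (k z) * k') z := by
  let _ : NormedAlgebra ℚ 𝔸 := NormedAlgebra.restrictScalars ℚ ℂ 𝔸
  have h1 : HasDerivAt (fun w => k w - k z) k' z := hk.sub_const _
  have h2 : HasFDerivAt NormedSpace.exp (1 : 𝔸 →L[ℂ] 𝔸) (k z - k z) := by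
    rw [sub_self]; exact hasFDerivAt_exp_zero
  have h3 : HasDerivAt (fun w => NormedSpace.exp (k w - k z)) k' z :=
    HasFDerivAt.comp_hasDerivAt (f := fun w => k w - k z) z h2 h1
  refine (h3.const_mul (NormedSpace.exp (k z))).congr_of_eventuallyEq ?_
  filter_upwards [hc] with w hw
  rw [← NormedSpace.exp_add_of_commute (hw.sub_right (Commute.refl _)), add_sub_cancel]

/-- The logarithm `log (1 + Y) = ∑ (-1)ᵐ Yᵐ⁺¹ / (m+1)` near `1` in a Banach algebra. -/
noncomputable def logOneAdd (Y : 𝔸) : 𝔸 := ∑' m : ℕ, ((-1) ^ m / (m + 1) : ℂ) • Y ^ (m + 1)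

theorem differentiableOn_logOneAdd {f : ℂ → 𝔸} {U : Set ℂ} (hU : IsOpen U)
    (hf : DifferentiableOn ℂ f U) {q : ℝ} (hq0 : 0 ≤ q) (hq : q < 1) (hfq : ∀ w ∈ U, ‖f w‖ ≤ q) :
    DifferentiableOn ℂ (fun w => logOneAdd (f w)) U := by
  unfold logOneAdd
  refine Complex.differentiableOn_tsum_of_summable_norm (u := fun m => q ^ (m + 1)) ?_ ?_ hU ?_
  · exact (summable_nat_add_iff 1).mpr (summable_geometric_of_lt_one hq0 hq)
  · intro m
    exact DifferentiableOn.const_smul (hf.fun_pow (m + 1)) ((-1) ^ m / (m + 1) : ℂ)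
  · intro m w hw
    exact (norm_log_term_le _ m).trans (pow_le_pow_left₀ (norm_nonneg _) (hfq w hw) _)

theorem norm_logOneAdd_sub_le {Y : 𝔸} (hY : ‖Y‖ ≤ 1 / 2) : ‖logOneAdd Y - Y‖ ≤ 2 * ‖Y‖ ^ 2 := by
  have hq : ‖Y‖ < 1 := by linarith
  have hs : Summable (fun m : ℕ => ((-1) ^ m / (m + 1) : ℂ) • Y ^ (m + 1)) :=
    Summable.of_norm_bounded
      ((summable_nat_add_iff 1).mpr (summable_geometric_of_lt_one (norm_nonneg Y) hq))
      (norm_log_term_le Y)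
  have h0 : logOneAdd Y - Y =
      ∑' m : ℕ, ((-1) ^ (m + 1) / ((m + 1 : ℕ) + 1) : ℂ) • Y ^ (m + 1 + 1) := by
    rw [logOneAdd, hs.tsum_eq_zero_add]; simp
  rw [h0]
  have hg := (hasSum_geometric_of_lt_one (norm_nonneg Y) hq).mul_left (‖Y‖ ^ 2)
  have h1 : ‖Y‖ ^ 2 * (1 - ‖Y‖)⁻¹ ≤ 2 * ‖Y‖ ^ 2 := by
    have : (1 - ‖Y‖)⁻¹ ≤ 2 := by
      rw [inv_le_comm₀ (by linarith) (by norm_num)]; linarith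
    nlinarith [sq_nonneg ‖Y‖]
  refine le_trans (tsum_of_norm_bounded hg fun m => ?_) h1
  refine (norm_log_term_le Y (m + 1)).trans (le_of_eq ?_)
  ring

/-- `exp (log (1 + Y)) = 1 + Y`, because `exp (-log (1 + w Y)) (1 + w Y)` has derivative zero in the
complex variable `w`. -/
theorem exp_logOneAdd {Y : 𝔸} (hY : ‖Y‖ < 1) : NormedSpace.exp (logOneAdd Y) = 1 + Y := by
  let _ : NormedAlgebra ℚ 𝔸 := NormedAlgebra.restrictScalars ℚ ℂ 𝔸
  -- a radius `R > 1` with `R ‖Y‖ < 1`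
  obtain ⟨R, hR1, hRY⟩ : ∃ R : ℝ, 1 < R ∧ R * ‖Y‖ < 1 := by
    have h0 := norm_nonneg Y
    refine ⟨2 / (1 + ‖Y‖), ?_, ?_⟩
    · rw [lt_div_iff₀ (by positivity)]; linarith
    · rw [div_mul_eq_mul_div, div_lt_one (by positivity)]; linarith
  have hR0 : 0 ≤ R * ‖Y‖ := by positivity
  set U := Metric.ball (0 : ℂ) R with hU
  set F : ℕ → ℂ → 𝔸 := fun m w => ((-1) ^ m / (m + 1) : ℂ) • (w • Y) ^ (m + 1) with hF
  have hsum : Summable (fun m : ℕ => (R * ‖Y‖) ^ (m + 1)) :=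
    (summable_nat_add_iff 1).mpr (summable_geometric_of_lt_one hR0 hRY)
  have hwY : ∀ w ∈ U, ‖w • Y‖ ≤ R * ‖Y‖ := by
    intro w hw
    rw [norm_smul]
    have : ‖w‖ < R := by simpa [hU] using hw
    gcongr
  have hFle : ∀ (m : ℕ), ∀ w ∈ U, ‖F m w‖ ≤ (R * ‖Y‖) ^ (m + 1) := fun m w hw =>
    (norm_log_term_le _ m).trans (pow_le_pow_left₀ (norm_nonneg _) (hwY w hw) _)
  have hFderiv : ∀ (m : ℕ) (w : ℂ), HasDerivAt (F m) (((-1) ^ m * w ^ m) • Y ^ (m + 1)) w := by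
    intro m w
    have h1 : F m = fun w : ℂ => ((-1) ^ m / (m + 1) * w ^ (m + 1) : ℂ) • Y ^ (m + 1) := by
      funext w; rw [hF]; simp only [smul_pow, smul_smul]
    rw [h1]
    have h2 : HasDerivAt (fun w : ℂ => ((-1) ^ m / (m + 1) * w ^ (m + 1) : ℂ))
        ((-1) ^ m * w ^ m) w := by
      have h := (hasDerivAt_pow (m + 1) w).const_mul ((-1) ^ m / (m + 1) : ℂ)
      refine h.congr_deriv ?_
      have : (m + 1 : ℂ) ≠ 0 := Nat.cast_add_one_ne_zero m
      push_cast
      field_simp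
    exact h2.smul_const _
  have hFd : ∀ m, DifferentiableOn ℂ (F m) U := fun m w _ =>
    (hFderiv m w).differentiableAt.differentiableWithinAt
  set h : ℂ → 𝔸 := fun w => logOneAdd (w • Y) with hh
  have hdiff : DifferentiableOn ℂ h U :=
    Complex.differentiableOn_tsum_of_summable_norm hsum hFd Metric.isOpen_ball hFle
  have hderiv : ∀ w ∈ U, (1 + w • Y) * deriv h w = Y := by
    intro w hw
    have hs := Complex.hasSum_deriv_of_summable_norm hsum hFd Metric.isOpen_ball hFle hw
    have e : (fun m => deriv (F m) w) = fun m : ℕ => ((-1) ^ m * w ^ m) • Y ^ (m + 1) := by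
      funext m; exact (hFderiv m w).deriv
    rw [e] at hs
    change HasSum _ (deriv h w) at hs
    have h1 := hs.tsum_eq
    rw [hs.summable.tsum_eq_zero_add] at h1
    have h2 := (hs.mul_left (w • Y)).tsum_eq
    have h3 : ∀ m : ℕ, ((-1) ^ (m + 1) * w ^ (m + 1)) • Y ^ (m + 1 + 1) =
        -(w • Y * (((-1) ^ m * w ^ m) • Y ^ (m + 1))) := by
      intro m
      rw [smul_mul_smul_comm, ← pow_succ', ← neg_smul]
      congr 1; ring
    simp only [h3, tsum_neg, h2] at h1
    rw [add_mul, one_mul]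
    nth_rewrite 1 [← h1]
    simp
  have hcomm : ∀ z w : ℂ, Commute (h z) (h w) := by
    intro z w
    refine Commute.tsum_right _ fun m => ?_
    refine (Commute.tsum_right _ fun k => ?_).symm
    refine Commute.smul_right (Commute.smul_left ?_ _) _
    refine Commute.pow_pow ?_ _ _
    exact ((Commute.refl Y).smul_left _).smul_right _
  have hu : ∀ w ∈ U, HasDerivAt (fun w => NormedSpace.exp (-h w) * (1 + w • Y)) 0 w := by
    intro w hw
    have hd : HasDerivAt h (deriv h w) w :=
      (hdiff.differentiableAt (Metric.isOpen_ball.mem_nhds hw)).hasDerivAt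
    have h1 : HasDerivAt (fun w => NormedSpace.exp (-h w))
        (NormedSpace.exp (-h w) * -deriv h w) w :=
      HasDerivAt.exp_of_eventually_commute hd.neg
        (Filter.Eventually.of_forall fun v => ((hcomm w v).neg_left).neg_right)
    have h2 : HasDerivAt (fun w : ℂ => 1 + w • Y) Y w := by
      simpa using ((hasDerivAt_id w).smul_const Y).const_add 1
    have h3 := h1.mul h2
    have hYc : Commute (1 + w • Y) (deriv h w) := by
      have hs := Complex.hasSum_deriv_of_summable_norm hsum hFd Metric.isOpen_ball hFle hw
      change HasSum _ (deriv h w) at hs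
      rw [← hs.tsum_eq]
      refine Commute.tsum_right _ fun m => ?_
      rw [(hFderiv m w).deriv]
      refine Commute.smul_right ?_ _
      exact (Commute.one_left _).add_left (((Commute.refl Y).smul_left w).pow_right _)
    refine h3.congr_deriv ?_
    rw [mul_assoc, neg_mul, ← hYc.eq, hderiv w hw]
    simp
  have h0U : (0 : ℂ) ∈ U := by simp [hU]; linarith
  have h1U : (1 : ℂ) ∈ U := by simpa [hU] using hR1
  have hconst := Metric.isOpen_ball.is_const_of_deriv_eq_zero
    (convex_ball (0 : ℂ) R).isPreconnected
    (fun w hw => (hu w hw).differentiableAt.differentiableWithinAt)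
    (fun w hw => (hu w hw).deriv) h1U h0U
  have h00 : h 0 = 0 := by simp [hh, logOneAdd]
  simp only [h00, neg_zero, NormedSpace.exp_zero, zero_smul, add_zero, one_smul, mul_one] at hconst
  have h11 : h 1 = logOneAdd Y := by simp [hh]
  rw [h11] at hconst
  have hinv : NormedSpace.exp (logOneAdd Y) * NormedSpace.exp (-logOneAdd Y) = 1 := by
    rw [← NormedSpace.exp_add_of_commute (Commute.refl _).neg_right, add_neg_cancel,
      NormedSpace.exp_zero]
  calc NormedSpace.exp (logOneAdd Y)
      = NormedSpace.exp (logOneAdd Y) * (NormedSpace.exp (-logOneAdd Y) * (1 + Y)) := by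
        rw [hconst, mul_one]
    _ = _ := by rw [← mul_assoc, hinv, one_mul]

/-- Perturbation bound: if `A` generates contractions, infinitesimally `‖1 + h A‖ ≤ 1 + O(h²)`,
then `‖exp (A + E)‖ ≤ exp ‖E‖`, as one sees from `exp (A + E) = (exp ((A + E) / N)) ^ N` for large
`N`. The size of `A` does not enter. -/
theorem norm_exp_add_le_exp_norm [NormOneClass 𝔸] {A : 𝔸} {K h₀ : ℝ} (hh₀ : 0 < h₀)
    (hA : ∀ h : ℝ, 0 ≤ h → h ≤ h₀ → ‖1 + (h : ℂ) • A‖ ≤ 1 + K * h ^ 2) (E : 𝔸) :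
    ‖NormedSpace.exp (A + E)‖ ≤ Real.exp ‖E‖ := by
  let _ : NormedAlgebra ℚ 𝔸 := NormedAlgebra.restrictScalars ℚ ℂ 𝔸
  obtain ⟨D, hD⟩ := (exp_sub_one_sub_isBigO (𝔸 := 𝔸)).bound
  have ht : Filter.Tendsto (fun N : ℕ => ((1 / ((N : ℝ) + 1) : ℝ) : ℂ) • (A + E)) Filter.atTop
      (nhds 0) := by
    have h1 : Filter.Tendsto (fun N : ℕ => ((1 / ((N : ℝ) + 1) : ℝ) : ℂ)) Filter.atTop
        (nhds 0) := by
      have := (Complex.continuous_ofReal.tendsto 0).comp tendsto_one_div_add_atTop_nhds_zero_nat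
      simpa only [Complex.ofReal_zero, Function.comp_def] using this
    simpa using h1.smul_const (A + E)
  set K' := K + D * ‖A + E‖ ^ 2 with hK'
  have hlim : Filter.Tendsto (fun N : ℕ => Real.exp (‖E‖ + K' * (1 / ((N : ℝ) + 1)))) Filter.atTop
      (nhds (Real.exp ‖E‖)) := by
    have := (tendsto_one_div_add_atTop_nhds_zero_nat (𝕜 := ℝ)).const_mul K' |>.const_add ‖E‖
    rw [mul_zero, add_zero] at this
    exact (Real.continuous_exp.tendsto _).comp this
  refine ge_of_tendsto hlim ?_
  have hsmall := (tendsto_order.mp (tendsto_one_div_add_atTop_nhds_zero_nat (𝕜 := ℝ))).2 h₀ hh₀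
  filter_upwards [ht.eventually hD, hsmall] with N hN hN0
  set s : ℝ := 1 / ((N : ℝ) + 1) with hs
  have hs0 : 0 ≤ s := by positivity
  have hsN : ((N : ℝ) + 1) * s = 1 := by rw [hs]; field_simp
  have hexp : NormedSpace.exp (A + E) = NormedSpace.exp ((s : ℂ) • (A + E)) ^ (N + 1) := by
    rw [← NormedSpace.exp_nsmul]
    congr 1
    rw [← Nat.cast_smul_eq_nsmul ℂ, smul_smul]
    have : (((N + 1 : ℕ) : ℂ)) * (s : ℂ) = 1 := by exact_mod_cast hsN
    rw [this, one_smul]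
  have hstep : ‖NormedSpace.exp ((s : ℂ) • (A + E))‖ ≤ 1 + (s * ‖E‖ + K' * s ^ 2) := by
    have e : NormedSpace.exp ((s : ℂ) • (A + E)) =
        (NormedSpace.exp ((s : ℂ) • (A + E)) - 1 - (s : ℂ) • (A + E)) +
          ((1 + (s : ℂ) • A) + (s : ℂ) • E) := by
      rw [smul_add]; abel
    rw [e]
    refine (norm_add_le _ _).trans ((add_le_add hN (norm_add_le _ _)).trans ?_)
    have h1 := hA s hs0 hN0.le
    have h2 : ‖(s : ℂ) • E‖ = s * ‖E‖ := by
      rw [norm_smul, Complex.norm_real, Real.norm_of_nonneg hs0]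
    have h3 : ‖(s : ℂ) • (A + E)‖ = s * ‖A + E‖ := by
      rw [norm_smul, Complex.norm_real, Real.norm_of_nonneg hs0]
    rw [h2, h3, Real.norm_of_nonneg (by positivity), hK']
    nlinarith
  rw [hexp]
  calc _ ≤ ‖NormedSpace.exp ((s : ℂ) • (A + E))‖ ^ (N + 1) := norm_pow_le _ _
    _ ≤ Real.exp (s * ‖E‖ + K' * s ^ 2) ^ (N + 1) := by
        gcongr
        refine hstep.trans ?_
        rw [add_comm]; exact Real.add_one_le_exp _
    _ = Real.exp (‖E‖ + K' * s) := by
        rw [← Real.exp_nat_mul]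
        congr 1
        push_cast
        linear_combination (‖E‖ + K' * s) * hsN

end BanachAlgebra

/-! ### The effective generator of an even family -/

section EvenFamily

variable {𝔸 : Type*} [NormedRing 𝔸] [NormedAlgebra ℂ 𝔸] [CompleteSpace 𝔸]
  {F : ℂ → 𝔸} {A : 𝔸} {Λ : ℝ}

/-- An even analytic family `F` with `F(x) = 1 + x² A + O(x³)`, bounded by `e⁴` on `|x|² Λ ≤ 1`:
evenness removes the cubic term, and the remainder is of order `(|x|² Λ)²`. -/
theorem even_family_expansion (hΛ : 0 < Λ) (hF : Differentiable ℂ F) (heven : ∀ x, F (-x) = F x)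
    (hF0 : F 0 = 1) (hbd : ∀ x : ℂ, ‖x‖ ^ 2 * Λ ≤ 1 → ‖F x‖ ≤ Real.exp 4)
    (hA : (fun x : ℂ => F x - (1 + x ^ 2 • A)) =O[nhds 0] fun x => ‖x‖ ^ 3)
    {x : ℂ} (hx : ‖x‖ ^ 2 * Λ ≤ 1 / 2) :
    ‖F x - 1‖ ≤ 2 * Real.exp 4 * (‖x‖ ^ 2 * Λ) ∧
      ‖F x - 1 - x ^ 2 • A‖ ≤ 2 * Real.exp 4 * (‖x‖ ^ 2 * Λ) ^ 2 := by
  set r := 1 / Real.sqrt Λ with hr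
  have hsq : 0 < Real.sqrt Λ := Real.sqrt_pos.mpr hΛ
  have hr0 : 0 < r := by positivity
  have hrsq : r ^ 2 = 1 / Λ := by rw [hr, div_pow, one_pow, Real.sq_sqrt hΛ.le]
  have hq : ∀ y : ℂ, (‖y‖ / r) ^ 2 = ‖y‖ ^ 2 * Λ := by
    intro y; rw [div_pow, hrsq]; field_simp
  obtain ⟨c, hc0, hc⟩ := exists_even_taylor (g := F) (r := r) (C := Real.exp 4) hr0
    hF.diffContOnCl (fun z hz => hbd z (by
      have : ‖z‖ = r := by simpa using hz
      rw [this, hrsq]; field_simp; exact le_rfl)) heven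
  rw [hF0] at hc0
  have hlt : ∀ y : ℂ, ‖y‖ ^ 2 * Λ ≤ 1 / 2 → ‖y‖ < r := by
    intro y hy
    have h1 : ‖y‖ ^ 2 < r ^ 2 := by
      rw [hrsq, lt_div_iff₀ hΛ]; linarith
    exact lt_of_pow_lt_pow_left₀ 2 hr0.le h1
  have hgen : ∀ (y : ℂ) (n : ℕ), ‖y‖ ^ 2 * Λ ≤ 1 / 2 →
      ‖F y - ∑ m ∈ Finset.range n, y ^ (2 * m) • c m‖ ≤ 2 * Real.exp 4 * (‖y‖ ^ 2 * Λ) ^ n := by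
    intro y n hy
    refine (hc n y (hlt y hy)).trans ?_
    rw [hq y, div_le_iff₀ (by linarith)]
    have h0 : 0 ≤ Real.exp 4 * (‖y‖ ^ 2 * Λ) ^ n := by positivity
    nlinarith
  have h1 := fun y hy => hgen y 1 hy
  have h2 := fun y hy => hgen y 2 hy
  simp only [Finset.sum_range_succ, Finset.sum_range_zero, zero_add, mul_zero, pow_zero, one_smul,
    hc0, mul_one, pow_one] at h1 h2
  -- the given expansion is only `O(x³)`, but it identifies the quadratic coefficient
  have hcA : c 1 = A := by
    obtain ⟨D, hD⟩ := hA.bound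
    -- along small real `t`, `t² ‖c₁ - A‖ = O(t³)`
    have hev : ∀ᶠ t : ℝ in nhdsWithin 0 (Set.Ioi 0),
        ‖c 1 - A‖ ≤ (D + 2 * Real.exp 4 * Λ ^ 2) * t := by
      have ht0 : Filter.Tendsto (fun t : ℝ => (t : ℂ)) (nhdsWithin 0 (Set.Ioi 0)) (nhds 0) := by
        have := Complex.continuous_ofReal.tendsto 0
        rw [Complex.ofReal_zero] at this
        exact this.mono_left nhdsWithin_le_nhds
      have hsm : ∀ᶠ t : ℝ in nhdsWithin 0 (Set.Ioi 0), t ^ 2 * Λ < 1 / 2 := by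
        have : Filter.Tendsto (fun t : ℝ => t ^ 2 * Λ) (nhds 0) (nhds (0 ^ 2 * Λ)) :=
          (Continuous.tendsto (by fun_prop) 0)
        rw [zero_pow two_ne_zero, zero_mul] at this
        exact (this.mono_left nhdsWithin_le_nhds).eventually (gt_mem_nhds (by norm_num))
      have hsm1 : ∀ᶠ t : ℝ in nhdsWithin 0 (Set.Ioi 0), t < 1 :=
        (Filter.tendsto_id.mono_left nhdsWithin_le_nhds).eventually (gt_mem_nhds one_pos)
      filter_upwards [ht0.eventually hD, hsm, hsm1, self_mem_nhdsWithin] with t h3 h4 h5 h6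
      have ht : 0 < t := h6
      have hn : ‖(t : ℂ)‖ = t := by rw [Complex.norm_real, Real.norm_of_nonneg ht.le]
      have h7 := h2 t (by rw [hn]; exact h4.le)
      rw [hn] at h3 h7
      rw [Real.norm_of_nonneg (by positivity)] at h3
      have e : ((t : ℂ) ^ 2) • (c 1 - A) = (F t - (1 + (t : ℂ) ^ 2 • A)) -
          (F t - (1 + (t : ℂ) ^ 2 • c 1)) := by rw [smul_sub]; abel
      have h8 : t ^ 2 * ‖c 1 - A‖ ≤ D * t ^ 3 + 2 * Real.exp 4 * (t ^ 2 * Λ) ^ 2 := by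
        have h8' : t ^ 2 * ‖c 1 - A‖ = ‖((t : ℂ) ^ 2) • (c 1 - A)‖ := by
          rw [norm_smul, norm_pow, hn]
        rw [h8', e]
        refine (norm_sub_le _ _).trans (add_le_add ?_ ?_)
        · exact h3
        · exact h7
      have h9 : t ^ 2 * ‖c 1 - A‖ ≤ t ^ 2 * ((D + 2 * Real.exp 4 * Λ ^ 2) * t) := by
        refine h8.trans ?_
        have : 2 * Real.exp 4 * (t ^ 2 * Λ) ^ 2 ≤ 2 * Real.exp 4 * Λ ^ 2 * t ^ 3 := by
          have h10 : t ^ 4 ≤ t ^ 3 := pow_le_pow_of_le_one ht.le h5.le (by norm_num)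
          calc _ = 2 * Real.exp 4 * Λ ^ 2 * t ^ 4 := by ring
            _ ≤ _ := by gcongr
        nlinarith
      exact le_of_mul_le_mul_left h9 (by positivity)
    have hlim : Filter.Tendsto (fun t : ℝ => (D + 2 * Real.exp 4 * Λ ^ 2) * t)
        (nhdsWithin 0 (Set.Ioi 0)) (nhds 0) := by
      have : Filter.Tendsto (fun t : ℝ => (D + 2 * Real.exp 4 * Λ ^ 2) * t) (nhds 0)
          (nhds ((D + 2 * Real.exp 4 * Λ ^ 2) * 0)) := Continuous.tendsto (by fun_prop) 0
      rw [mul_zero] at this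
      exact this.mono_left nhdsWithin_le_nhds
    have := ge_of_tendsto hlim hev
    exact sub_eq_zero.mp (norm_le_zero_iff.mp this)
  refine ⟨h1 x hx, ?_⟩
  have := h2 x hx
  rwa [hcA, ← sub_sub] at this

/-- The effective generator `x⁻² log F(x)` of the family `F`, with the value `A` at `0`. -/
noncomputable def effectiveGenerator (F : ℂ → 𝔸) (A : 𝔸) (x : ℂ) : 𝔸 :=
  if x = 0 then A else (x ^ 2)⁻¹ • logOneAdd (F x - 1)

theorem norm_effectiveGenerator_sub_le (hΛ : 1 ≤ Λ) (hF : Differentiable ℂ F)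
    (heven : ∀ x, F (-x) = F x)
    (hF0 : F 0 = 1) (hbd : ∀ x : ℂ, ‖x‖ ^ 2 * Λ ≤ 1 → ‖F x‖ ≤ Real.exp 4)
    (hA : (fun x : ℂ => F x - (1 + x ^ 2 • A)) =O[nhds 0] fun x => ‖x‖ ^ 3)
    {x : ℂ} (hx : 4 * Real.exp 4 * (‖x‖ ^ 2 * Λ) ≤ 1) :
    ‖effectiveGenerator F A x - A‖ ≤ (4 * Real.exp 4 * Λ * ‖x‖) ^ 2 := by
  have he : 1 ≤ Real.exp 4 := Real.one_le_exp (by norm_num)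
  have hΛ0 : 0 < Λ := by linarith
  unfold effectiveGenerator
  split_ifs with h0
  · simp [h0]
  · have hxΛ : 0 ≤ ‖x‖ ^ 2 * Λ := by positivity
    obtain ⟨h1, h2⟩ := even_family_expansion hΛ0 hF heven hF0 hbd hA (x := x) (by nlinarith)
    have h3 : ‖F x - 1‖ ≤ 1 / 2 := by linarith
    have h4 := norm_logOneAdd_sub_le h3
    have hx0 : 0 < ‖x‖ := norm_pos_iff.mpr h0
    have e : (x ^ 2)⁻¹ • logOneAdd (F x - 1) - A = (x ^ 2)⁻¹ •
        ((logOneAdd (F x - 1) - (F x - 1)) + (F x - 1 - x ^ 2 • A)) := by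
      rw [sub_add_sub_cancel, smul_sub, inv_smul_smul₀ (pow_ne_zero 2 h0)]
    rw [e, norm_smul, norm_inv, norm_pow, inv_mul_le_iff₀ (by positivity)]
    refine (norm_add_le _ _).trans ((add_le_add h4 h2).trans ?_)
    have h5 : ‖F x - 1‖ ^ 2 ≤ (2 * Real.exp 4 * (‖x‖ ^ 2 * Λ)) ^ 2 :=
      pow_le_pow_left₀ (norm_nonneg _) h1 2
    have h6 : 2 * Real.exp 4 * (‖x‖ ^ 2 * Λ) ^ 2 ≤ 2 * Real.exp 4 ^ 2 * (‖x‖ ^ 2 * Λ) ^ 2 := by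
      gcongr; nlinarith
    nlinarith [sq_nonneg (Real.exp 4 * (‖x‖ ^ 2 * Λ))]

/-- If moreover `‖F(t)‖ ≤ 1` for real `t`, then `A` is infinitesimally contractive in the sense of
`norm_exp_add_le_exp_norm`, and `exp` of the effective generator is bounded by `e` on the
disc `|x| ≤ 1 / (4 e⁴ Λ)`. -/
theorem norm_exp_effectiveGenerator_le [NormOneClass 𝔸] (hΛ : 1 ≤ Λ) (hF : Differentiable ℂ F)
    (heven : ∀ x, F (-x) = F x)
    (hF0 : F 0 = 1) (hbd : ∀ x : ℂ, ‖x‖ ^ 2 * Λ ≤ 1 → ‖F x‖ ≤ Real.exp 4)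
    (hA : (fun x : ℂ => F x - (1 + x ^ 2 • A)) =O[nhds 0] fun x => ‖x‖ ^ 3)
    (hcontr : ∀ t : ℝ, ‖F t‖ ≤ 1)
    {x : ℂ} (hx : 4 * Real.exp 4 * Λ * ‖x‖ ≤ 1) :
    ‖NormedSpace.exp (effectiveGenerator F A x)‖ ≤ Real.exp 1 := by
  have hΛ0 : 0 < Λ := by linarith
  have he : 1 ≤ Real.exp 4 := Real.one_le_exp (by norm_num)
  have hx1 : ‖x‖ ≤ 1 := by nlinarith [norm_nonneg x, mul_nonneg (norm_nonneg x) hΛ0.le]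
  have hdis : ∀ h : ℝ, 0 ≤ h → h ≤ 1 / (2 * Λ) →
      ‖1 + (h : ℂ) • A‖ ≤ 1 + 2 * Real.exp 4 * Λ ^ 2 * h ^ 2 := by
    intro h h0 h1
    have hn : ‖((Real.sqrt h : ℝ) : ℂ)‖ ^ 2 = h := by
      rw [Complex.norm_real, Real.norm_of_nonneg (Real.sqrt_nonneg h), Real.sq_sqrt h0]
    have hs : ((Real.sqrt h : ℝ) : ℂ) ^ 2 = (h : ℂ) := by
      rw [← Complex.ofReal_pow, Real.sq_sqrt h0]
    have hle : h * Λ ≤ 1 / 2 := by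
      rw [le_div_iff₀ (by positivity)] at h1; linarith
    have h2 := (even_family_expansion hΛ0 hF heven hF0 hbd hA (x := ((Real.sqrt h : ℝ) : ℂ))
      (by rw [hn]; exact hle)).2
    rw [hn, hs] at h2
    have e : 1 + (h : ℂ) • A = F (Real.sqrt h : ℝ) - (F (Real.sqrt h : ℝ) - 1 - (h : ℂ) • A) := by
      abel
    rw [e]
    refine (norm_sub_le _ _).trans ((add_le_add (hcontr _) h2).trans (le_of_eq ?_))
    ring
  have hE := norm_effectiveGenerator_sub_le hΛ hF heven hF0 hbd hA (x := x) (by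
    have : ‖x‖ ^ 2 ≤ ‖x‖ := by nlinarith [norm_nonneg x]
    calc _ ≤ 4 * Real.exp 4 * (‖x‖ * Λ) := by gcongr
      _ ≤ 1 := by linarith)
  have h1 := norm_exp_add_le_exp_norm (by positivity) hdis (effectiveGenerator F A x - A)
  rw [add_sub_cancel] at h1
  refine h1.trans (Real.exp_le_exp.mpr (hE.trans ?_))
  exact pow_le_one₀ (by positivity) hx

/-- The singularity of `x⁻² log F(x)` at `0` is removable, by continuity. -/
theorem differentiableOn_exp_effectiveGenerator (hΛ : 1 ≤ Λ) (hF : Differentiable ℂ F)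
    (heven : ∀ x, F (-x) = F x)
    (hF0 : F 0 = 1) (hbd : ∀ x : ℂ, ‖x‖ ^ 2 * Λ ≤ 1 → ‖F x‖ ≤ Real.exp 4)
    (hA : (fun x : ℂ => F x - (1 + x ^ 2 • A)) =O[nhds 0] fun x => ‖x‖ ^ 3) :
    DifferentiableOn ℂ (fun x => NormedSpace.exp (effectiveGenerator F A x))
      (Metric.ball 0 (2 / (4 * Real.exp 4 * Λ))) := by
  have hΛ0 : 0 < Λ := by linarith
  have he : 1 ≤ Real.exp 4 := Real.one_le_exp (by norm_num)
  set R := 2 / (4 * Real.exp 4 * Λ) with hR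
  have hR0 : 0 < R := by positivity
  have hsmall : ∀ x ∈ Metric.ball (0 : ℂ) R, 4 * Real.exp 4 * (‖x‖ ^ 2 * Λ) ≤ 1 := by
    intro x hx
    have hx' : ‖x‖ < R := by simpa using hx
    have h1 : ‖x‖ * (2 * Real.exp 4 * Λ) ≤ 1 := by
      rw [hR, lt_div_iff₀ (by positivity)] at hx'; linarith
    have h0 := norm_nonneg x
    have h2 : ‖x‖ ≤ 1 / 2 := by
      have : ‖x‖ * 2 ≤ ‖x‖ * (2 * Real.exp 4 * Λ) := by
        gcongr
        nlinarith
      linarith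
    have h3 : 0 ≤ ‖x‖ * (2 * Real.exp 4 * Λ) := by positivity
    nlinarith
  have hS : DifferentiableOn ℂ (effectiveGenerator F A) (Metric.ball 0 R) := by
    rw [← Complex.differentiableOn_compl_singleton_and_continuousAt_iff
      (Metric.ball_mem_nhds (0 : ℂ) hR0)]
    constructor
    · have hopen : IsOpen (Metric.ball (0 : ℂ) R \ {0}) :=
        Metric.isOpen_ball.sdiff isClosed_singleton
      have hlog : DifferentiableOn ℂ (fun x => logOneAdd (F x - 1))
          (Metric.ball (0 : ℂ) R \ {0}) := by
        refine differentiableOn_logOneAdd hopen (hF.sub_const 1).differentiableOn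
          (q := 1 / 2) (by norm_num) (by norm_num) fun x hx => ?_
        have h1 := hsmall x hx.1
        have h0 : 0 ≤ ‖x‖ ^ 2 * Λ := by positivity
        have h2 := (even_family_expansion hΛ0 hF heven hF0 hbd hA (x := x) (by nlinarith)).1
        linarith
      have hinv : DifferentiableOn ℂ (fun x : ℂ => (x ^ 2)⁻¹) (Metric.ball (0 : ℂ) R \ {0}) :=
        ((differentiable_id.pow 2).differentiableOn).inv fun x hx => pow_ne_zero 2 hx.2
      refine (hinv.smul hlog).congr fun x hx => ?_
      simp only [effectiveGenerator, if_neg (show x ≠ 0 from hx.2), Pi.smul_apply']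
    · have h0 : effectiveGenerator F A 0 = A := if_pos rfl
      rw [ContinuousAt, h0, tendsto_iff_norm_sub_tendsto_zero]
      have hlim : Filter.Tendsto (fun x : ℂ => (4 * Real.exp 4 * Λ * ‖x‖) ^ 2) (nhds 0)
          (nhds 0) := by
        have : Filter.Tendsto (fun x : ℂ => (4 * Real.exp 4 * Λ * ‖x‖) ^ 2) (nhds 0)
          (nhds ((4 * Real.exp 4 * Λ * ‖(0 : ℂ)‖) ^ 2)) := Continuous.tendsto (by fun_prop) 0
        simpa using this
      refine tendsto_of_tendsto_of_tendsto_of_le_of_le' tendsto_const_nhds hlim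
        (Filter.Eventually.of_forall fun _ => norm_nonneg _) ?_
      filter_upwards [Metric.ball_mem_nhds (0 : ℂ) hR0] with x hx
      exact norm_effectiveGenerator_sub_le hΛ hF heven hF0 hbd hA (hsmall x hx)
  intro x hx
  exact ((NormedSpace.exp_analytic (𝕂 := ℂ) _).differentiableAt).comp_differentiableWithinAt x
    (hS x hx)

/-- At `x = 1 / √k` the effective generator reproduces `k` steps exactly. -/
theorem exp_effectiveGenerator_eq_pow {x : ℂ} {k : ℕ} (hk : 0 < k) (hx : x ^ 2 = 1 / (k : ℂ))
    (hFx : ‖F x - 1‖ < 1) : NormedSpace.exp (effectiveGenerator F A x) = F x ^ k := by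
  let _ : NormedAlgebra ℚ 𝔸 := NormedAlgebra.restrictScalars ℚ ℂ 𝔸
  have hk0 : (k : ℂ) ≠ 0 := by exact_mod_cast hk.ne'
  have hx0 : x ≠ 0 := by
    rintro rfl
    rw [zero_pow two_ne_zero] at hx
    exact one_div_ne_zero hk0 hx.symm
  rw [effectiveGenerator, if_neg hx0, hx, one_div, inv_inv, Nat.cast_smul_eq_nsmul ℂ,
    NormedSpace.exp_nsmul, exp_logOneAdd hFx, add_sub_cancel]

end EvenFamily

theorem effectiveGenerator_neg {𝔸 : Type*} [NormedRing 𝔸] [NormedAlgebra ℂ 𝔸]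
    {F : ℂ → 𝔸} {A : 𝔸} (heven : ∀ x, F (-x) = F x) (x : ℂ) :
    effectiveGenerator F A (-x) = effectiveGenerator F A x := by
  simp [effectiveGenerator, heven]

/-! ### One step in the Heisenberg picture -/

section Dilation
open scoped Matrix Matrix.Norms.L2Operator

theorem norm_exp_le_exp_norm {𝔸 : Type*} [NormedRing 𝔸] [NormedAlgebra ℂ 𝔸] [CompleteSpace 𝔸]
    (h1 : ‖(1 : 𝔸)‖ ≤ 1) (X : 𝔸) : ‖NormedSpace.exp X‖ ≤ Real.exp ‖X‖ := by
  have h := NormedSpace.expSeries_div_hasSum_exp (𝔸 := ℝ) ‖X‖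
  rw [← Real.exp_eq_exp_ℝ] at h
  rw [NormedSpace.exp_eq_tsum ℂ]
  refine tsum_of_norm_bounded h fun n => ?_
  rw [norm_smul, norm_inv, Complex.norm_natCast, inv_mul_eq_div]
  gcongr
  rcases Nat.eq_zero_or_pos n with rfl | hn
  · simpa using h1
  · exact norm_pow_le' X hn

theorem opNorm_eq_norm {d : ℕ} (A : Op d) : opNorm A = ‖A‖ := rfl

theorem norm_one_matrix_le {m : Type*} [Fintype m] [DecidableEq m] : ‖(1 : Matrix m m ℂ)‖ ≤ 1 := by
  rw [← Matrix.diagonal_one, Matrix.l2_opNorm_diagonal]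
  exact (pi_norm_le_iff_of_nonneg zero_le_one).mpr fun _ => by simp

variable {d J : ℕ}

/-- The embedding `X ↦ 1 ⊗ X` of the system observables. -/
noncomputable def embedSystem (d J : ℕ) : Op d →⋆ₙₐ[ℂ] DilatedOp J d where
  toFun X := (1 : Matrix (Fin (J + 1)) (Fin (J + 1)) ℂ) ⊗ₖ X
  map_smul' c X := Matrix.kronecker_smul c 1 X
  map_zero' := Matrix.kronecker_zero _
  map_add' X Y := Matrix.kronecker_add _ X Y
  map_mul' X Y := by rw [← Matrix.mul_kronecker_mul, one_mul]
  map_star' X := by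
    rw [Matrix.star_eq_conjTranspose, Matrix.star_eq_conjTranspose, Matrix.conjTranspose_kronecker,
      Matrix.conjTranspose_one]

/-- `X ↦ 1 ⊗ X` as a continuous linear map. -/
noncomputable def embedCLM (d J : ℕ) : Op d →L[ℂ] DilatedOp J d :=
  LinearMap.mkContinuous
    { toFun := fun X => embedSystem d J X
      map_add' := map_add _
      map_smul' := map_smul _ } 1
    fun X => by rw [one_mul]; exact NonUnitalStarAlgHom.norm_apply_le (embedSystem d J) X

theorem embedCLM_apply (X : Op d) :
    embedCLM d J X = (1 : Matrix (Fin (J + 1)) (Fin (J + 1)) ℂ) ⊗ₖ X := rfl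

theorem norm_embedCLM_le : ‖embedCLM d J‖ ≤ 1 :=
  LinearMap.mkContinuous_norm_le _ zero_le_one _

/-- The isometry `|0⟩ ⊗ 1` from the system into ancilla ⊗ system. -/
def ancillaIsometry (d J : ℕ) : Matrix (Fin (J + 1) × Fin d) (Fin d) ℂ :=
  Matrix.of fun p k => if p = (0, k) then 1 else 0

theorem ancillaIsometry_conj_mul (Y : DilatedOp J d) (i k : Fin d) :
    ((ancillaIsometry d J)ᴴ * Y * ancillaIsometry d J) i k = Y (0, i) (0, k) := by
  simp only [Matrix.mul_apply, Matrix.conjTranspose_apply, ancillaIsometry, Matrix.of_apply]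
  rw [Finset.sum_eq_single (0, k) (fun p _ hp => by simp [hp]) (by simp)]
  rw [Finset.sum_eq_single (0, i) (fun p _ hp => by simp [hp]) (by simp)]
  simp

theorem norm_ancillaIsometry_le : ‖ancillaIsometry d J‖ ≤ 1 := by
  have h : (ancillaIsometry d J)ᴴ * ancillaIsometry d J = 1 := by
    ext i k
    have := ancillaIsometry_conj_mul (J := J) (1 : DilatedOp J d) i k
    rw [Matrix.mul_one] at this
    rw [this]
    simp [Matrix.one_apply]
  have h2 := Matrix.l2_opNorm_conjTranspose_mul_self (ancillaIsometry d J)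
  rw [h] at h2
  have h3 := norm_one_matrix_le (m := Fin d)
  nlinarith [norm_nonneg (ancillaIsometry d J)]

/-- The compression `Y ↦ ⟨0| Y |0⟩` to the ancilla state `|0⟩`. -/
noncomputable def compressCLM (d J : ℕ) : DilatedOp J d →L[ℂ] Op d :=
  LinearMap.mkContinuous
    { toFun := fun Y => Matrix.of fun i k => Y (0, i) (0, k)
      map_add' := fun _ _ => rfl
      map_smul' := fun _ _ => rfl } 1
    fun Y => by
      have h : (Matrix.of fun i k => Y (0, i) (0, k)) =
          (ancillaIsometry d J)ᴴ * Y * ancillaIsometry d J := by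
        ext i k; rw [ancillaIsometry_conj_mul]; rfl
      change ‖(Matrix.of fun i k => Y (0, i) (0, k) : Op d)‖ ≤ 1 * ‖Y‖
      rw [h, one_mul]
      have h1 := norm_ancillaIsometry_le (d := d) (J := J)
      have h2 : ‖(ancillaIsometry d J)ᴴ‖ ≤ 1 := by rwa [Matrix.l2_opNorm_conjTranspose]
      calc _ ≤ ‖(ancillaIsometry d J)ᴴ‖ * ‖Y‖ * ‖ancillaIsometry d J‖ :=
            (Matrix.l2_opNorm_mul _ _).trans (by gcongr; exact Matrix.l2_opNorm_mul _ _)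
        _ ≤ 1 * ‖Y‖ * 1 := by gcongr
        _ = ‖Y‖ := by ring

theorem compressCLM_apply (Y : DilatedOp J d) (i k : Fin d) :
    compressCLM d J Y i k = Y (0, i) (0, k) := rfl

theorem norm_compressCLM_le : ‖compressCLM d J‖ ≤ 1 :=
  LinearMap.mkContinuous_norm_le _ zero_le_one _

theorem compress_kronecker (K : Matrix (Fin (J + 1)) (Fin (J + 1)) ℂ) (X : Op d) :
    compressCLM d J (K ⊗ₖ X) = K 0 0 • X := by
  ext i k; rfl

/-- The dilated Hamiltonian as a polynomial in `x = √τ`, for complex `x`. -/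
noncomputable def dilationPoly (H : Op d) (L : Fin J → Op d) (x : ℂ) : DilatedOp J d :=
  x ^ 2 • dilationH0 J H + x • dilationH1 L

theorem dilatedHamiltonian_eq (H : Op d) (L : Fin J → Op d) {τ : ℝ} (hτ : 0 ≤ τ) :
    dilatedHamiltonian H L τ = dilationPoly H L ((Real.sqrt τ : ℝ) : ℂ) := by
  rw [dilatedHamiltonian, dilationPoly, ← Complex.ofReal_pow, Real.sq_sqrt hτ]

/-- One step in the Heisenberg picture, `X ↦ ⟨0| e^{iH(x)} (1 ⊗ X) e^{-iH(x)} |0⟩`, where `x` is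
the square root of the step size. -/
noncomputable def heisenbergStep (H : Op d) (L : Fin J → Op d) (x : ℂ) : Op d →L[ℂ] Op d :=
  compressCLM d J ∘L
    (ContinuousLinearMap.mul ℂ (DilatedOp J d) (NormedSpace.exp (Complex.I • dilationPoly H L x)) *
      (ContinuousLinearMap.mul ℂ (DilatedOp J d)).flip
        (NormedSpace.exp ((-Complex.I) • dilationPoly H L x))) ∘L embedCLM d J

theorem heisenbergStep_apply (H : Op d) (L : Fin J → Op d) (x : ℂ) (X : Op d) :
    heisenbergStep H L x X = compressCLM d J (NormedSpace.exp (Complex.I • dilationPoly H L x) *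
      (((1 : Matrix (Fin (J + 1)) (Fin (J + 1)) ℂ) ⊗ₖ X) *
        NormedSpace.exp ((-Complex.I) • dilationPoly H L x))) := rfl

theorem trace_traceAncilla_mul (Y : DilatedOp J d) (X : Op d) :
    (traceAncilla Y * X).trace = (Y * ((1 : Matrix (Fin (J + 1)) (Fin (J + 1)) ℂ) ⊗ₖ X)).trace := by
  have h1 : (traceAncilla Y * X).trace = ∑ i, ∑ k, ∑ a, Y (a, i) (a, k) * X k i := by
    simp only [Matrix.trace, Matrix.diag, Matrix.mul_apply, traceAncilla, Matrix.of_apply,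
      Finset.sum_mul]
  have h2 : (Y * ((1 : Matrix (Fin (J + 1)) (Fin (J + 1)) ℂ) ⊗ₖ X)).trace =
      ∑ a, ∑ i, ∑ k, Y (a, i) (a, k) * X k i := by
    simp only [Matrix.trace, Matrix.diag, Matrix.mul_apply, Fintype.sum_prod_type,
      Matrix.kroneckerMap_apply, Matrix.one_apply]
    refine Finset.sum_congr rfl fun a _ => Finset.sum_congr rfl fun i _ => ?_
    rw [Finset.sum_eq_single a (fun b _ hb => by simp [hb]) (by simp)]
    simp
  rw [h1, h2, Finset.sum_comm_cycle]

theorem trace_ketBra_kronecker_mul (ρ : Op d) (W : DilatedOp J d) :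
    ((ketBra (J := J) 0 0 ⊗ₖ ρ) * W).trace = (ρ * compressCLM d J W).trace := by
  simp only [Matrix.trace, Matrix.diag, Matrix.mul_apply, compressCLM_apply,
    Fintype.sum_prod_type, Matrix.kroneckerMap_apply, ketBra]
  rw [Finset.sum_eq_single 0]
  · refine Finset.sum_congr rfl fun i _ => ?_
    rw [Finset.sum_eq_single 0]
    · simp
    · intro b _ hb
      simp [hb.symm]
    · simp
  · intro b _ hb
    simp [hb.symm]
  · simp

/-- Duality between the Schrödinger and the Heisenberg pictures for one step. -/
theorem trace_dilationStep_mul (H : Op d) (L : Fin J → Op d) {τ : ℝ} (hτ : 0 ≤ τ) (ρ X : Op d) :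
    (dilationStep H L τ ρ * X).trace =
      (ρ * heisenbergStep H L ((Real.sqrt τ : ℝ) : ℂ) X).trace := by
  rw [dilationStep, trace_traceAncilla_mul, heisenbergStep_apply, ← trace_ketBra_kronecker_mul,
    ← dilatedHamiltonian_eq H L hτ, mul_assoc, mul_assoc, Matrix.trace_mul_comm]
  simp only [mul_assoc]

theorem trace_iterate_dilationStep_mul (H : Op d) (L : Fin J → Op d) {τ : ℝ} (hτ : 0 ≤ τ) (k : ℕ)
    (ρ X : Op d) :
    ((dilationStep H L τ)^[k] ρ * X).trace =
      (ρ * (heisenbergStep H L ((Real.sqrt τ : ℝ) : ℂ) ^ k) X).trace := by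
  induction k generalizing X with
  | zero => simp
  | succ k ih =>
    rw [Function.iterate_succ_apply', trace_dilationStep_mul H L hτ, ih, pow_succ]
    rfl

theorem differentiable_heisenbergStep (H : Op d) (L : Fin J → Op d) :
    Differentiable ℂ (heisenbergStep H L) := by
  have hp : Differentiable ℂ (dilationPoly H L) := by
    unfold dilationPoly; fun_prop
  have he : ∀ c : ℂ, Differentiable ℂ fun x => NormedSpace.exp (c • dilationPoly H L x) := by
    intro c x
    exact (NormedSpace.exp_analytic (𝕂 := ℂ) _).differentiableAt.comp x ((hp x).const_smul c)
  unfold heisenbergStep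
  have h1 : Differentiable ℂ fun x => ContinuousLinearMap.mul ℂ (DilatedOp J d)
      (NormedSpace.exp (Complex.I • dilationPoly H L x)) :=
    (ContinuousLinearMap.mul ℂ (DilatedOp J d)).differentiable.comp (he _)
  have h2 : Differentiable ℂ fun x => (ContinuousLinearMap.mul ℂ (DilatedOp J d)).flip
      (NormedSpace.exp ((-Complex.I) • dilationPoly H L x)) :=
    (ContinuousLinearMap.mul ℂ (DilatedOp J d)).flip.differentiable.comp (he _)
  exact (differentiable_const _).clm_comp ((h1.mul h2).clm_comp (differentiable_const _))

theorem norm_heisenbergStep_le (H : Op d) (L : Fin J → Op d) (x : ℂ) :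
    ‖heisenbergStep H L x‖ ≤ ‖NormedSpace.exp (Complex.I • dilationPoly H L x)‖ *
      ‖NormedSpace.exp ((-Complex.I) • dilationPoly H L x)‖ := by
  refine ContinuousLinearMap.opNorm_le_bound _ (by positivity) fun X => ?_
  rw [heisenbergStep_apply, ← embedCLM_apply]
  refine ((compressCLM d J).le_of_opNorm_le norm_compressCLM_le _).trans ?_
  rw [one_mul]
  have h := (embedCLM d J).le_of_opNorm_le norm_embedCLM_le X
  calc _ ≤ ‖NormedSpace.exp (Complex.I • dilationPoly H L x)‖ * (‖embedCLM d J X‖ *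
        ‖NormedSpace.exp ((-Complex.I) • dilationPoly H L x)‖) :=
        (norm_mul_le _ _).trans (by gcongr; exact norm_mul_le _ _)
    _ ≤ ‖NormedSpace.exp (Complex.I • dilationPoly H L x)‖ * ((1 * ‖X‖) *
        ‖NormedSpace.exp ((-Complex.I) • dilationPoly H L x)‖) := by gcongr
    _ = _ := by ring

/-! ### Parity of the step -/

/-- The parity operator, `+1` on the ancilla state `|0⟩` and `-1` on the others. -/
def ancillaParity (d J : ℕ) : DilatedOp J d :=
  Matrix.diagonal fun p => if p.1 = 0 then 1 else -1

theorem ancillaParity_mul_self : ancillaParity d J * ancillaParity d J = 1 := by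
  rw [ancillaParity, Matrix.diagonal_mul_diagonal, ← Matrix.diagonal_one]
  congr 1
  funext p
  split_ifs <;> simp

theorem ancillaParity_conj_apply (Y : DilatedOp J d) (p q : Fin (J + 1) × Fin d) :
    (ancillaParity d J * Y * ancillaParity d J) p q =
      (if p.1 = 0 then 1 else -1) * Y p q * (if q.1 = 0 then 1 else -1) := by
  rw [ancillaParity, Matrix.mul_diagonal, Matrix.diagonal_mul]

theorem ancillaParity_conj_dilationPoly (H : Op d) (L : Fin J → Op d) (x : ℂ) :
    ancillaParity d J * dilationPoly H L x * ancillaParity d J = dilationPoly H L (-x) := by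
  have h0 : ancillaParity d J * dilationH0 J H * ancillaParity d J = dilationH0 J H := by
    ext p q
    rw [ancillaParity_conj_apply, dilationH0, Matrix.kroneckerMap_apply, ketBra]
    by_cases hp : p.1 = 0 <;> by_cases hq : q.1 = 0 <;>
      simp [hp, hq, eq_comm]
  have h1 : ancillaParity d J * dilationH1 L * ancillaParity d J = -dilationH1 L := by
    ext p q
    rw [ancillaParity_conj_apply, dilationH1, Matrix.neg_apply, Matrix.sum_apply, Finset.mul_sum,
      Finset.sum_mul, ← Finset.sum_neg_distrib]
    refine Finset.sum_congr rfl fun j _ => ?_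
    rw [Matrix.add_apply, Matrix.kroneckerMap_apply, Matrix.kroneckerMap_apply, ketBra, ketBra]
    by_cases hp : p.1 = 0 <;> by_cases hq : q.1 = 0 <;>
      simp [hp, hq, Matrix.single_apply, eq_comm, neg_ite]
  rw [dilationPoly, dilationPoly, mul_add, add_mul, mul_smul_comm, mul_smul_comm, smul_mul_assoc,
    smul_mul_assoc, h0, h1, neg_sq, smul_neg, neg_smul]

theorem ancillaParity_conj_exp (H : Op d) (L : Fin J → Op d) (x c : ℂ) :
    NormedSpace.exp (c • dilationPoly H L (-x)) =
      ancillaParity d J * NormedSpace.exp (c • dilationPoly H L x) * ancillaParity d J := by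
  have hZ := ancillaParity_mul_self (d := d) (J := J)
  have hinv : (ancillaParity d J)⁻¹ = ancillaParity d J := Matrix.inv_eq_left_inv hZ
  have hu : IsUnit (ancillaParity d J) := IsUnit.of_mul_eq_one _ hZ
  have h := Matrix.exp_conj (ancillaParity d J) (c • dilationPoly H L x) hu
  rw [hinv, mul_smul_comm, smul_mul_assoc, ancillaParity_conj_dilationPoly] at h
  exact h

/-- A step depends only on `x² = τ`: the ancilla parity reverses the sign of `H₁`, and it fixes the
ancilla state `|0⟩` and commutes with `1 ⊗ X`. -/
theorem heisenbergStep_neg (H : Op d) (L : Fin J → Op d) (x : ℂ) :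
    heisenbergStep H L (-x) = heisenbergStep H L x := by
  ext1 X
  rw [heisenbergStep_apply, heisenbergStep_apply, ancillaParity_conj_exp, ancillaParity_conj_exp]
  set Z := ancillaParity d J with hZdef
  have hZ : Z * Z = 1 := ancillaParity_mul_self
  set E := NormedSpace.exp (Complex.I • dilationPoly H L x)
  set E' := NormedSpace.exp ((-Complex.I) • dilationPoly H L x)
  set B := (1 : Matrix (Fin (J + 1)) (Fin (J + 1)) ℂ) ⊗ₖ X with hB
  have hZB : Z * B * Z = B := by
    ext p q
    rw [hZdef, ancillaParity_conj_apply, hB, Matrix.kroneckerMap_apply, Matrix.one_apply]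
    by_cases h : p.1 = q.1
    · rw [h]; split_ifs <;> simp
    · simp [h]
  have e : Z * E * Z * (B * (Z * E' * Z)) = Z * (E * (B * E')) * Z := by
    calc _ = Z * (E * ((Z * B * Z) * E')) * Z := by simp only [mul_assoc]
      _ = _ := by rw [hZB]
  rw [e]
  ext i k
  rw [compressCLM_apply, compressCLM_apply, hZdef, ancillaParity_conj_apply]
  simp

theorem heisenbergStep_zero (H : Op d) (L : Fin J → Op d) : heisenbergStep H L 0 = 1 := by
  ext1 X
  rw [heisenbergStep_apply, dilationPoly]
  simp [NormedSpace.exp_zero, compress_kronecker]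

/-! ### Norm bounds for the step -/

theorem norm_ketBra_zero_kronecker_le (X : Op d) : ‖ketBra (J := J) 0 0 ⊗ₖ X‖ ≤ ‖X‖ := by
  have h : ketBra (J := J) 0 0 ⊗ₖ X = ancillaIsometry d J * X * (ancillaIsometry d J)ᴴ := by
    ext ⟨a, i⟩ ⟨b, k⟩
    simp only [Matrix.mul_apply, Matrix.conjTranspose_apply, ancillaIsometry, Matrix.of_apply,
      Matrix.kroneckerMap_apply, ketBra, Matrix.single_apply]
    by_cases ha : a = 0 <;> by_cases hb : b = 0 <;>
      simp [ha, hb, Ne.symm]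
  have h1 := norm_ancillaIsometry_le (d := d) (J := J)
  have h2 : ‖(ancillaIsometry d J)ᴴ‖ ≤ 1 := by rwa [Matrix.l2_opNorm_conjTranspose]
  rw [h]
  calc _ ≤ ‖ancillaIsometry d J‖ * ‖X‖ * ‖(ancillaIsometry d J)ᴴ‖ :=
        (Matrix.l2_opNorm_mul _ _).trans (by gcongr; exact Matrix.l2_opNorm_mul _ _)
    _ ≤ 1 * ‖X‖ * 1 := by gcongr
    _ = ‖X‖ := by ring

/-- The part `∑ⱼ |j⟩⟨0| ⊗ Lⱼ` of the dilated Hamiltonian that leaves the ancilla state `|0⟩`. -/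
noncomputable def jumpPart (L : Fin J → Op d) : DilatedOp J d :=
  ∑ j : Fin J, ketBra j.succ 0 ⊗ₖ L j

theorem conjTranspose_ketBra (a b : Fin (J + 1)) : (ketBra a b)ᴴ = ketBra (J := J) b a := by
  simp [ketBra, Matrix.conjTranspose_single]

theorem conjTranspose_jumpPart (L : Fin J → Op d) :
    (jumpPart L)ᴴ = ∑ j : Fin J, ketBra 0 j.succ ⊗ₖ (L j)ᴴ := by
  simp [jumpPart, Matrix.conjTranspose_sum, Matrix.conjTranspose_kronecker, conjTranspose_ketBra]

theorem dilationH1_eq (L : Fin J → Op d) : dilationH1 L = jumpPart L + (jumpPart L)ᴴ := by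
  rw [conjTranspose_jumpPart, dilationH1, jumpPart, Finset.sum_add_distrib]

theorem conjTranspose_jumpPart_mul_mul (L : Fin J → Op d) (X : Op d) :
    (jumpPart L)ᴴ * ((1 : Matrix (Fin (J + 1)) (Fin (J + 1)) ℂ) ⊗ₖ X) * jumpPart L =
      ketBra 0 0 ⊗ₖ ∑ j, (L j)ᴴ * X * L j := by
  rw [conjTranspose_jumpPart, jumpPart, Finset.sum_mul, Finset.sum_mul]
  have hk : ketBra (J := J) 0 0 ⊗ₖ ∑ j, (L j)ᴴ * X * L j =
      ∑ j, ketBra (J := J) 0 0 ⊗ₖ ((L j)ᴴ * X * L j) := by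
    ext p q
    simp [Matrix.kroneckerMap_apply, Matrix.sum_apply, Finset.mul_sum]
  rw [hk]
  refine Finset.sum_congr rfl fun j _ => ?_
  rw [Finset.mul_sum, Finset.sum_eq_single j]
  · rw [← Matrix.mul_kronecker_mul, ← Matrix.mul_kronecker_mul, Matrix.mul_one]
    simp [ketBra]
  · intro i _ hij
    rw [← Matrix.mul_kronecker_mul, ← Matrix.mul_kronecker_mul, Matrix.mul_one]
    have : ketBra (J := J) 0 j.succ * ketBra i.succ 0 = 0 := by
      rw [ketBra, ketBra, Matrix.single_mul_single_of_ne]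
      simpa using Ne.symm hij
    rw [this, Matrix.zero_kronecker]
  · simp

/-- The square appears because the `|j⟩⟨0| ⊗ Lⱼ` have orthogonal ranges in the ancilla. -/
theorem norm_jumpPart_sq_le (L : Fin J → Op d) : ‖jumpPart L‖ ^ 2 ≤ ∑ j, ‖L j‖ ^ 2 := by
  have h := conjTranspose_jumpPart_mul_mul L (1 : Op d)
  rw [Matrix.one_kronecker_one, Matrix.mul_one] at h
  rw [sq, ← Matrix.l2_opNorm_conjTranspose_mul_self, h]
  refine (norm_ketBra_zero_kronecker_le _).trans ((norm_sum_le _ _).trans ?_)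
  refine Finset.sum_le_sum fun j _ => ?_
  rw [Matrix.mul_one, Matrix.l2_opNorm_conjTranspose_mul_self, sq]

theorem norm_dilationPoly_le {H : Op d} {L : Fin J → Op d} {Λ : ℝ}
    (hΛ : generatorSize H L ≤ Λ) {x : ℂ} (hx : ‖x‖ ^ 2 * Λ ≤ 1) :
    ‖dilationPoly H L x‖ ≤ 2 := by
  have hgs : 2 * ‖H‖ + 2 * ∑ j, ‖L j‖ ^ 2 ≤ Λ := hΛ
  have hL0 : 0 ≤ ∑ j, ‖L j‖ ^ 2 := Finset.sum_nonneg fun _ _ => by positivity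
  have hH0 := norm_nonneg H
  have h0 : ‖dilationH0 J H‖ ≤ ‖H‖ := norm_ketBra_zero_kronecker_le H
  have h1 : ‖dilationH1 L‖ ≤ 2 * ‖jumpPart L‖ := by
    rw [dilationH1_eq]
    refine (norm_add_le _ _).trans ?_
    rw [Matrix.l2_opNorm_conjTranspose]; linarith
  have h2 := norm_jumpPart_sq_le L
  have h3 : ‖x‖ ^ 2 * ‖dilationH0 J H‖ ≤ 1 / 2 := by
    calc _ ≤ ‖x‖ ^ 2 * (Λ / 2) := by gcongr; linarith
      _ ≤ _ := by linarith
  have h4 : (‖x‖ * ‖jumpPart L‖) ^ 2 ≤ 1 / 2 := by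
    calc _ = ‖x‖ ^ 2 * ‖jumpPart L‖ ^ 2 := by ring
      _ ≤ ‖x‖ ^ 2 * (Λ / 2) := by gcongr; linarith
      _ ≤ _ := by linarith
  have h5 : ‖x‖ * ‖jumpPart L‖ ≤ 3 / 4 := by
    by_contra! h
    nlinarith
  rw [dilationPoly]
  refine (norm_add_le _ _).trans ?_
  rw [norm_smul, norm_smul, norm_pow]
  have h6 : ‖x‖ * ‖dilationH1 L‖ ≤ 3 / 2 := by
    calc _ ≤ ‖x‖ * (2 * ‖jumpPart L‖) := by gcongr
      _ ≤ _ := by linarith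
  linarith

/-- A bound that is uniform on the disc `|x|² ≤ 1 / Λ`. -/
theorem norm_heisenbergStep_le_exp {H : Op d} {L : Fin J → Op d} {Λ : ℝ}
    (hΛ : generatorSize H L ≤ Λ) {x : ℂ} (hx : ‖x‖ ^ 2 * Λ ≤ 1) :
    ‖heisenbergStep H L x‖ ≤ Real.exp 4 := by
  have h := norm_dilationPoly_le hΛ hx
  have hE : ∀ c : ℂ, ‖c‖ = 1 → ‖NormedSpace.exp (c • dilationPoly H L x)‖ ≤ Real.exp 2 := by
    intro c hc
    refine (norm_exp_le_exp_norm norm_one_matrix_le _).trans (Real.exp_le_exp.mpr ?_)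
    rwa [norm_smul, hc, one_mul]
  refine (norm_heisenbergStep_le H L x).trans ?_
  calc _ ≤ Real.exp 2 * Real.exp 2 := by
        gcongr
        · exact hE _ (by simp)
        · exact hE _ (by simp)
    _ = _ := by rw [← Real.exp_add]; norm_num

theorem dilationH0_isHermitian {H : Op d} (hH : H.IsHermitian) :
    (dilationH0 J H).IsHermitian := by
  rw [Matrix.IsHermitian, dilationH0, Matrix.conjTranspose_kronecker, conjTranspose_ketBra, hH.eq]

theorem dilationH1_isHermitian (L : Fin J → Op d) : (dilationH1 L).IsHermitian := by
  rw [Matrix.IsHermitian, dilationH1_eq, Matrix.conjTranspose_add,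
    Matrix.conjTranspose_conjTranspose, add_comm (jumpPart L)]

theorem dilationPoly_isHermitian {H : Op d} (hH : H.IsHermitian) (L : Fin J → Op d) (t : ℝ) :
    (dilationPoly H L t).IsHermitian := by
  rw [Matrix.IsHermitian, dilationPoly, Matrix.conjTranspose_add, Matrix.conjTranspose_smul,
    Matrix.conjTranspose_smul, (dilationH0_isHermitian hH).eq, (dilationH1_isHermitian L).eq]
  simp

theorem conjTranspose_exp_smul {m : Type*} [Fintype m] [DecidableEq m] {A : Matrix m m ℂ}
    (hA : A.IsHermitian) :
    (NormedSpace.exp (Complex.I • A))ᴴ = NormedSpace.exp ((-Complex.I) • A) := by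
  rw [← Matrix.exp_conjTranspose, Matrix.conjTranspose_smul, hA.eq]
  simp

theorem exp_smul_mul_exp_neg_smul {m : Type*} [Fintype m] [DecidableEq m] (A : Matrix m m ℂ)
    (c : ℂ) : NormedSpace.exp (c • A) * NormedSpace.exp ((-c) • A) = 1 := by
  rw [← Matrix.exp_add_of_commute _ _ (((Commute.refl A).smul_left _).smul_right _), ← add_smul,
    add_neg_cancel, zero_smul, NormedSpace.exp_zero]

theorem norm_exp_I_smul_le {m : Type*} [Fintype m] [DecidableEq m] {A : Matrix m m ℂ}
    (hA : A.IsHermitian) :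
    ‖NormedSpace.exp (Complex.I • A)‖ ≤ 1 ∧ ‖NormedSpace.exp ((-Complex.I) • A)‖ ≤ 1 := by
  have h : ‖NormedSpace.exp ((-Complex.I) • A)‖ ≤ 1 := by
    have h1 := Matrix.l2_opNorm_conjTranspose_mul_self (NormedSpace.exp ((-Complex.I) • A))
    rw [← conjTranspose_exp_smul hA, Matrix.conjTranspose_conjTranspose, conjTranspose_exp_smul hA,
      exp_smul_mul_exp_neg_smul] at h1
    have h2 := norm_one_matrix_le (m := m)
    nlinarith [norm_nonneg (NormedSpace.exp ((-Complex.I) • A))]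
  refine ⟨?_, h⟩
  rwa [← conjTranspose_exp_smul hA, Matrix.l2_opNorm_conjTranspose] at h

/-- In the Heisenberg picture a step of real size is contractive in operator norm. -/
theorem norm_heisenbergStep_ofReal_le {H : Op d} (hH : H.IsHermitian) (L : Fin J → Op d) (t : ℝ) :
    ‖heisenbergStep H L t‖ ≤ 1 := by
  obtain ⟨h1, h2⟩ := norm_exp_I_smul_le (dilationPoly_isHermitian hH L t)
  exact (norm_heisenbergStep_le H L t).trans (mul_le_one₀ h1 (norm_nonneg _) h2)

end Dilation

/-! ### Second-order expansion of the step -/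

theorem pow_smul_isBigO {E : Type*} [NormedAddCommGroup E] [NormedSpace ℂ E] (v : E) {m n : ℕ}
    (h : n ≤ m) : (fun x : ℂ => x ^ m • v) =O[nhds 0] fun x => ‖x‖ ^ n := by
  refine Asymptotics.IsBigO.of_bound ‖v‖ ?_
  filter_upwards [Metric.ball_mem_nhds (0 : ℂ) one_pos] with x hx
  have hx1 : ‖x‖ ≤ 1 := by
    have : ‖x‖ < 1 := by simpa using hx
    exact this.le
  rw [norm_smul, norm_pow, Real.norm_of_nonneg (by positivity), mul_comm]
  exact mul_le_mul_of_nonneg_left (pow_le_pow_of_le_one (norm_nonneg _) hx1 h) (norm_nonneg _)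

/-- Second-order expansions multiply. -/
theorem mul_expansion_isBigO {𝔹 : Type*} [NormedRing 𝔹] [NormedAlgebra ℂ 𝔹] {f g : ℂ → 𝔹}
    {f₁ f₂ g₁ g₂ : 𝔹}
    (hf : (fun x => f x - (1 + x • f₁ + x ^ 2 • f₂)) =O[nhds 0] fun x => ‖x‖ ^ 3)
    (hg : (fun x => g x - (1 + x • g₁ + x ^ 2 • g₂)) =O[nhds 0] fun x => ‖x‖ ^ 3) :
    (fun x => f x * g x - (1 + x • (f₁ + g₁) + x ^ 2 • (f₂ + f₁ * g₁ + g₂))) =O[nhds 0]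
      fun x => ‖x‖ ^ 3 := by
  have hone : ∀ (a b : 𝔹), (fun x : ℂ => 1 + x • a + x ^ 2 • b) =O[nhds 0] fun _ => (1 : ℝ) := by
    intro a b
    exact (Continuous.tendsto (by fun_prop) (0 : ℂ)).isBigO_one ℝ
  have h3 : (fun x : ℂ => ‖x‖ ^ 3) =O[nhds 0] fun _ => (1 : ℝ) :=
    (Continuous.tendsto (by fun_prop) (0 : ℂ)).isBigO_one ℝ
  have hgone : g =O[nhds 0] fun _ => (1 : ℝ) := by
    refine ((hg.trans h3).add (hone g₁ g₂)).congr_left fun x => ?_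
    abel
  have e1 := hf.mul hgone
  have e2 := (hone f₁ f₂).mul hg
  have e3 := (pow_smul_isBigO (f₁ * g₂ + f₂ * g₁) (le_refl 3)).add
    (pow_smul_isBigO (f₂ * g₂) (show 3 ≤ 4 by norm_num))
  simp only [mul_one, one_mul] at e1 e2
  refine ((e1.add e2).add e3).congr_left fun x => ?_
  simp only [sub_mul, mul_sub, add_mul, mul_add, one_mul, mul_one, smul_mul_assoc, mul_smul_comm,
    smul_add, smul_smul, ← pow_succ', ← pow_succ, ← pow_add]
  module

section DualGenerator
open scoped Matrix Matrix.Norms.L2Operator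

variable {d J : ℕ}

theorem exp_dilationPoly_expansion (H : Op d) (L : Fin J → Op d) (c : ℂ) :
    (fun x => NormedSpace.exp (c • dilationPoly H L x) -
      (1 + x • (c • dilationH1 L) +
        x ^ 2 • (c • dilationH0 J H + (c ^ 2 / 2) • dilationH1 L ^ 2))) =O[nhds 0]
      fun x => ‖x‖ ^ 3 := by
  have hcont : Filter.Tendsto (fun x => c • dilationPoly H L x) (nhds 0) (nhds 0) := by
    have : Continuous fun x => c • dilationPoly H L x := by unfold dilationPoly; fun_prop
    have h := this.tendsto 0
    simpa [dilationPoly] using h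
  have h1 := (exp_sub_quadratic_isBigO (𝔸 := DilatedOp J d)).comp_tendsto hcont
  have h2 : (fun x => c • dilationPoly H L x) =O[nhds 0] fun x => ‖x‖ := by
    have e := ((pow_smul_isBigO (dilationH0 J H) (show 1 ≤ 2 by norm_num)).add
      (pow_smul_isBigO (dilationH1 L) (le_refl 1))).const_smul_left c
    simp only [pow_one] at e
    exact e
  have h3 := h1.trans ((h2.norm_left).pow 3)
  have e3 := (pow_smul_isBigO ((c ^ 2 / 2) • (dilationH0 J H * dilationH1 L +
    dilationH1 L * dilationH0 J H)) (le_refl 3)).add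
    (pow_smul_isBigO ((c ^ 2 / 2) • dilationH0 J H ^ 2) (show 3 ≤ 4 by norm_num))
  refine (h3.add e3).congr_left fun x => ?_
  simp only [Function.comp, dilationPoly]
  simp only [sq, add_mul, mul_add, smul_mul_assoc, mul_smul_comm, smul_add, smul_smul]
  module

/-- The generator in the Heisenberg picture, i.e. the adjoint of the Lindblad generator: the
coefficient of `x² = τ` in the expansion of `heisenbergStep`. -/
noncomputable def dualLindbladian (H : Op d) (L : Fin J → Op d) : Op d →L[ℂ] Op d :=
  compressCLM d J ∘L
    (ContinuousLinearMap.mul ℂ (DilatedOp J d)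
        (Complex.I • dilationH0 J H + (Complex.I ^ 2 / 2) • dilationH1 L ^ 2) +
      ContinuousLinearMap.mul ℂ (DilatedOp J d) (Complex.I • dilationH1 L) *
        (ContinuousLinearMap.mul ℂ (DilatedOp J d)).flip ((-Complex.I) • dilationH1 L) +
      (ContinuousLinearMap.mul ℂ (DilatedOp J d)).flip
        ((-Complex.I) • dilationH0 J H + ((-Complex.I) ^ 2 / 2) • dilationH1 L ^ 2)) ∘L
    embedCLM d J

theorem dilationH1_zero_zero (L : Fin J → Op d) (i k : Fin d) : dilationH1 L (0, i) (0, k) = 0 := by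
  rw [dilationH1, Matrix.sum_apply]
  refine Finset.sum_eq_zero fun j _ => ?_
  rw [Matrix.add_apply, Matrix.kroneckerMap_apply, Matrix.kroneckerMap_apply, ketBra, ketBra]
  simp

theorem jumpPart_zero_apply (L : Fin J → Op d) (i : Fin d) (p : Fin (J + 1) × Fin d) :
    jumpPart L (0, i) p = 0 := by
  rw [jumpPart, Matrix.sum_apply]
  refine Finset.sum_eq_zero fun j _ => ?_
  rw [Matrix.kroneckerMap_apply, ketBra]
  simp

theorem compress_mul_embed (Y : DilatedOp J d) (X : Op d) :
    compressCLM d J (Y * ((1 : Matrix (Fin (J + 1)) (Fin (J + 1)) ℂ) ⊗ₖ X)) =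
      compressCLM d J Y * X := by
  ext i k
  simp only [compressCLM_apply, Matrix.mul_apply, Fintype.sum_prod_type, Matrix.kroneckerMap_apply]
  rw [Finset.sum_eq_single 0]
  · simp
  · intro b _ hb; simp [hb]
  · simp

theorem compress_embed_mul (Y : DilatedOp J d) (X : Op d) :
    compressCLM d J (((1 : Matrix (Fin (J + 1)) (Fin (J + 1)) ℂ) ⊗ₖ X) * Y) =
      X * compressCLM d J Y := by
  ext i k
  simp only [compressCLM_apply, Matrix.mul_apply, Fintype.sum_prod_type, Matrix.kroneckerMap_apply]
  rw [Finset.sum_eq_single 0]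
  · simp
  · intro b _ hb; simp [hb.symm]
  · simp

theorem compress_dilationH0 (H : Op d) : compressCLM d J (dilationH0 J H) = H := by
  rw [dilationH0, compress_kronecker]; simp [ketBra]

theorem compress_dilationH1 (L : Fin J → Op d) : compressCLM d J (dilationH1 L) = 0 := by
  ext i k; exact dilationH1_zero_zero L i k

theorem compress_dilationH1_mul_mul (L : Fin J → Op d) (X : Op d) :
    compressCLM d J (dilationH1 L * ((1 : Matrix (Fin (J + 1)) (Fin (J + 1)) ℂ) ⊗ₖ X) *
      dilationH1 L) = ∑ j, (L j)ᴴ * X * L j := by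
  set B := (1 : Matrix (Fin (J + 1)) (Fin (J + 1)) ℂ) ⊗ₖ X with hB
  have h1 : ∀ Y, compressCLM d J (jumpPart L * Y) = 0 := by
    intro Y
    ext i k
    rw [compressCLM_apply, Matrix.mul_apply]
    exact Finset.sum_eq_zero fun p _ => by rw [jumpPart_zero_apply, zero_mul]
  have h2 : ∀ Y, compressCLM d J (Y * (jumpPart L)ᴴ) = 0 := by
    intro Y
    ext i k
    rw [compressCLM_apply, Matrix.mul_apply]
    exact Finset.sum_eq_zero fun p _ => by
      rw [Matrix.conjTranspose_apply, jumpPart_zero_apply, star_zero, mul_zero]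
  have e : dilationH1 L * B * dilationH1 L = jumpPart L * (B * dilationH1 L) +
      (jumpPart L)ᴴ * B * jumpPart L + ((jumpPart L)ᴴ * B) * (jumpPart L)ᴴ := by
    rw [dilationH1_eq]; noncomm_ring
  rw [e, map_add, map_add, h1, h2, hB, conjTranspose_jumpPart_mul_mul, compress_kronecker]
  simp [ketBra]

/-- The explicit form of the Heisenberg generator. -/
theorem dualLindbladian_apply (H : Op d) (L : Fin J → Op d) (X : Op d) :
    dualLindbladian H L X = Complex.I • (H * X - X * H) +
      ∑ j, ((L j)ᴴ * X * L j - (1 / 2 : ℂ) • ((L j)ᴴ * L j * X + X * ((L j)ᴴ * L j))) := by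
  have hsq : compressCLM d J (dilationH1 L ^ 2) = ∑ j, (L j)ᴴ * L j := by
    have := compress_dilationH1_mul_mul L (1 : Op d)
    rw [Matrix.one_kronecker_one, Matrix.mul_one] at this
    rw [sq, this]; simp
  have h : dualLindbladian H L X = compressCLM d J
      ((Complex.I • dilationH0 J H + (Complex.I ^ 2 / 2) • dilationH1 L ^ 2) *
          ((1 : Matrix (Fin (J + 1)) (Fin (J + 1)) ℂ) ⊗ₖ X) +
        (Complex.I • dilationH1 L) * (((1 : Matrix (Fin (J + 1)) (Fin (J + 1)) ℂ) ⊗ₖ X) *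
          ((-Complex.I) • dilationH1 L)) +
        ((1 : Matrix (Fin (J + 1)) (Fin (J + 1)) ℂ) ⊗ₖ X) *
          ((-Complex.I) • dilationH0 J H + ((-Complex.I) ^ 2 / 2) • dilationH1 L ^ 2)) := rfl
  rw [h, map_add, map_add, compress_mul_embed, compress_embed_mul, mul_smul_comm, mul_smul_comm,
    smul_mul_assoc, smul_smul, ← mul_assoc, map_smul, compress_dilationH1_mul_mul]
  simp only [map_add, map_smul, compress_dilationH0, hsq, Finset.sum_sub_distrib,
    ← Finset.smul_sum, Finset.sum_add_distrib, ← Finset.sum_mul, ← Finset.mul_sum]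
  have hI : -Complex.I * Complex.I = 1 := by rw [neg_mul, Complex.I_mul_I, neg_neg]
  rw [hI, one_smul, neg_sq, Complex.I_sq, Matrix.add_mul, Matrix.mul_add]
  simp only [Matrix.smul_mul, Matrix.mul_smul]
  module

/-- The linear term vanishes because `⟨0| H₁ |0⟩ = 0`. -/
theorem heisenbergStep_expansion (H : Op d) (L : Fin J → Op d) :
    (fun x : ℂ => heisenbergStep H L x - (1 + x ^ 2 • dualLindbladian H L)) =O[nhds 0]
      fun x => ‖x‖ ^ 3 := by
  set μ := ContinuousLinearMap.mul ℂ (DilatedOp J d) with hμ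
  have hlin : ∀ (T : DilatedOp J d →L[ℂ] (DilatedOp J d →L[ℂ] DilatedOp J d)), T 1 = 1 →
      ∀ c : ℂ, (fun x => T (NormedSpace.exp (c • dilationPoly H L x)) -
      (1 + x • T (c • dilationH1 L) +
        x ^ 2 • T (c • dilationH0 J H + (c ^ 2 / 2) • dilationH1 L ^ 2))) =O[nhds 0]
      fun x => ‖x‖ ^ 3 := by
    intro T hT c
    refine ((T.isBigO_comp _ _).trans (exp_dilationPoly_expansion H L c)).congr_left fun x => ?_
    rw [map_sub, map_add, map_add, hT, T.map_smul x, T.map_smul (x ^ 2)]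
  have h1 := hlin μ (by ext1 Y; simp [hμ]) Complex.I
  have h2 := hlin μ.flip (by ext1 Y; simp [hμ]) (-Complex.I)
  have h3 := mul_expansion_isBigO (𝔹 := DilatedOp J d →L[ℂ] DilatedOp J d) h1 h2
  set Φ : (DilatedOp J d →L[ℂ] DilatedOp J d) →L[ℂ] (Op d →L[ℂ] Op d) :=
    (ContinuousLinearMap.compL ℂ (Op d) (DilatedOp J d) (Op d) (compressCLM d J)) ∘L
      ((ContinuousLinearMap.compL ℂ (Op d) (DilatedOp J d) (DilatedOp J d)).flip (embedCLM d J))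
    with hΦ
  refine ((Φ.isBigO_comp _ _).trans h3).congr_left fun x => ?_
  have hΦ1 : Φ 1 = 1 := by
    ext1 X
    change compressCLM d J ((1 : Matrix (Fin (J + 1)) (Fin (J + 1)) ℂ) ⊗ₖ X) = X
    rw [compress_kronecker]; simp
  have hΦ2 : Φ (μ (Complex.I • dilationH1 L) + μ.flip ((-Complex.I) • dilationH1 L)) = 0 := by
    ext1 X
    change compressCLM d J ((Complex.I • dilationH1 L) *
      ((1 : Matrix (Fin (J + 1)) (Fin (J + 1)) ℂ) ⊗ₖ X) +
      ((1 : Matrix (Fin (J + 1)) (Fin (J + 1)) ℂ) ⊗ₖ X) * ((-Complex.I) • dilationH1 L)) = 0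
    rw [map_add, compress_mul_embed, compress_embed_mul, map_smul, map_smul, compress_dilationH1]
    simp
  rw [map_sub, map_add, map_add, Φ.map_smul x, Φ.map_smul (x ^ 2), hΦ1, hΦ2, smul_zero, add_zero]
  rfl

theorem trace_mul_dissipator {m : Type*} [Fintype m] (K ρ X : Matrix m m ℂ) :
    ((K * ρ * Kᴴ - (1 / 2 : ℂ) • (Kᴴ * K * ρ + ρ * (Kᴴ * K))) * X).trace =
      (ρ * (Kᴴ * X * K - (1 / 2 : ℂ) • (Kᴴ * K * X + X * (Kᴴ * K)))).trace := by
  have h1 : (K * ρ * Kᴴ * X).trace = (ρ * (Kᴴ * X * K)).trace := by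
    rw [Matrix.mul_assoc, Matrix.mul_assoc, Matrix.trace_mul_comm, Matrix.mul_assoc]
  have h2 : (Kᴴ * K * ρ * X).trace = (ρ * (X * (Kᴴ * K))).trace := by
    rw [Matrix.mul_assoc, Matrix.trace_mul_comm, Matrix.mul_assoc]
  rw [Matrix.sub_mul, Matrix.mul_sub, Matrix.trace_sub, Matrix.trace_sub, h1, Matrix.smul_mul,
    Matrix.mul_smul, Matrix.trace_smul, Matrix.trace_smul, Matrix.add_mul, Matrix.mul_add,
    Matrix.trace_add, Matrix.trace_add, h2, Matrix.mul_assoc ρ, add_comm]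

theorem trace_lindbladian_mul (H : Op d) (L : Fin J → Op d) (ρ X : Op d) :
    (lindbladian H L ρ * X).trace = (ρ * dualLindbladian H L X).trace := by
  have h1 : (H * ρ * X).trace = (ρ * (X * H)).trace := by
    rw [Matrix.mul_assoc, Matrix.trace_mul_comm, Matrix.mul_assoc]
  rw [dualLindbladian_apply, lindbladian, Matrix.add_mul, Matrix.mul_add, Matrix.trace_add,
    Matrix.trace_add, Matrix.sum_mul, Matrix.mul_sum, Matrix.trace_sum, Matrix.trace_sum]
  congr 1
  · rw [Matrix.smul_mul, Matrix.mul_smul, Matrix.trace_smul, Matrix.trace_smul, Matrix.sub_mul,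
      Matrix.mul_sub, Matrix.trace_sub, Matrix.trace_sub, h1, Matrix.mul_assoc, smul_eq_mul,
      smul_eq_mul]
    ring
  · exact Finset.sum_congr rfl fun j _ => trace_mul_dissipator (L j) ρ X

end DualGenerator

/-! ### Exact evolution and density operators -/

theorem hasDerivAt_exp_sub_smul {𝔸 : Type*} [NormedRing 𝔸] [NormedAlgebra ℂ 𝔸] [CompleteSpace 𝔸]
    (D : 𝔸) (T t : ℝ) :
    HasDerivAt (fun s : ℝ => NormedSpace.exp (((T : ℂ) - s) • D))
      (-(D * NormedSpace.exp (((T : ℂ) - t) • D))) t := by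
  have h1 := hasDerivAt_exp_smul_const' (𝕂 := ℂ) D ((T : ℂ) - (t : ℂ))
  have h2 : HasDerivAt (fun s : ℝ => (T : ℂ) - (s : ℂ)) (-1) t := by
    simpa using ((hasDerivAt_id t).ofReal_comp).const_sub (T : ℂ)
  simpa [Function.comp_def] using h1.scomp t h2

section Evolution
open scoped Matrix Matrix.Norms.L2Operator

variable {d J : ℕ}

theorem dualLindbladian_smul (H : Op d) (L : Fin J → Op d) {T : ℝ} (hT : 0 ≤ T) :
    dualLindbladian ((T : ℂ) • H) (fun j => ((Real.sqrt T : ℝ) : ℂ) • L j) =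
      (T : ℂ) • dualLindbladian H L := by
  have hs : ((Real.sqrt T : ℝ) : ℂ) * ((Real.sqrt T : ℝ) : ℂ) = T := by
    rw [← Complex.ofReal_mul, Real.mul_self_sqrt hT]
  ext1 X
  change _ = (T : ℂ) • dualLindbladian H L X
  rw [dualLindbladian_apply, dualLindbladian_apply, smul_add, Finset.smul_sum]
  congr 1
  · rw [Matrix.smul_mul, Matrix.mul_smul, ← smul_sub, smul_comm]
  · refine Finset.sum_congr rfl fun j _ => ?_
    simp only [Matrix.conjTranspose_smul, Complex.star_def, Complex.conj_ofReal, Matrix.smul_mul,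
      Matrix.mul_smul, smul_smul, hs]
    module

theorem generatorSize_smul (H : Op d) (L : Fin J → Op d) {T : ℝ} (hT : 0 ≤ T) :
    generatorSize ((T : ℂ) • H) (fun j => ((Real.sqrt T : ℝ) : ℂ) • L j) =
      T * generatorSize H L := by
  simp only [generatorSize, opNorm_eq_norm, norm_smul, Complex.norm_real,
    Real.norm_of_nonneg hT, Real.norm_of_nonneg (Real.sqrt_nonneg T), mul_pow, Real.sq_sqrt hT,
    ← Finset.mul_sum]
  ring

/-- Expectation values along a solution of the Lindblad equation, in the Heisenberg picture. -/
theorem trace_solution_mul {H : Op d} {L : Fin J → Op d} {T : ℝ} (hT : 0 < T) {ρ₀ : Op d}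
    {ρ : ℝ → Op d} (hρ : IsLindbladSolution H L T ρ₀ ρ) (O : Op d) :
    (ρ T * O).trace = (ρ₀ * NormedSpace.exp ((T : ℂ) • dualLindbladian H L) O).trace := by
  set D := dualLindbladian H L with hD
  -- the pairing of `ρ(t)` with the observable evolved backwards from time `T` is constant
  set Y : ℝ → Op d := fun t => NormedSpace.exp (((T : ℂ) - t) • D) O with hY
  have hYd : ∀ t : ℝ, HasDerivAt Y (-(D (Y t))) t := by
    intro t
    have h3 := hasDerivAt_exp_sub_smul D T t
    exact ((ContinuousLinearMap.apply ℂ (Op d) O).restrictScalars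
      ℝ).hasFDerivAt.comp_hasDerivAt t h3
  have hYe : ∀ (t : ℝ) (i j : Fin d), HasDerivAt (fun s => Y s i j) (-(D (Y t)) i j) t := by
    intro t i j
    have := ((LinearMap.toContinuousLinearMap (Matrix.entryLinearMap ℂ ℂ i j)).restrictScalars
      ℝ).hasFDerivAt.comp_hasDerivAt t (hYd t)
    exact this
  have htr : ∀ A B : Op d, (A * B).trace = ∑ i, ∑ j, A i j * B j i := fun A B => rfl
  have hφ : ∀ t ∈ Set.Icc 0 T, HasDerivWithinAt (fun t => (ρ t * Y t).trace) 0 (Set.Icc 0 T) t := by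
    intro t ht
    have h1 : HasDerivWithinAt (fun t => ∑ i, ∑ j, ρ t i j * Y t j i)
        (∑ i, ∑ j, (lindbladian H L (ρ t) i j * Y t j i + ρ t i j * (-(D (Y t)) j i)))
        (Set.Icc 0 T) t :=
      HasDerivWithinAt.fun_sum fun i _ => HasDerivWithinAt.fun_sum fun j _ =>
        (hρ.2 t ht i j).mul (hYe t j i).hasDerivWithinAt
    refine h1.congr_deriv ?_
    have h2 := trace_lindbladian_mul H L (ρ t) (Y t)
    rw [htr, htr] at h2
    simp only [Finset.sum_add_distrib, h2, mul_neg, Finset.sum_neg_distrib]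
    exact add_neg_cancel _
  have hconst := constant_of_derivWithin_zero (f := fun t => (ρ t * Y t).trace) (a := 0) (b := T)
    (fun t ht => (hφ t ht).differentiableWithinAt)
    (fun t ht => (hφ t (Set.Ico_subset_Icc_self ht)).derivWithin
      (uniqueDiffOn_Icc hT t (Set.Ico_subset_Icc_self ht))) T (Set.right_mem_Icc.mpr hT.le)
  have hYT : Y T = O := by
    have h0 : ((T : ℂ) - (T : ℝ)) • D = 0 := by rw [sub_self]; exact zero_smul ℂ D
    rw [hY]
    simp only
    rw [h0, NormedSpace.exp_zero]
    rfl
  simp only [hYT] at hconst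
  rw [hconst, hρ.1, hY]
  simp only [Complex.ofReal_zero, sub_zero]

/-- The trace as a sum of quadratic forms over an orthonormal eigenbasis. -/
theorem trace_eq_sum_eigenvectorBasis {O : Op d} (hO : O.IsHermitian) (M : Op d) :
    M.trace = ∑ i,
      dotProduct (star ⇑(hO.eigenvectorBasis i)) (M.mulVec ⇑(hO.eigenvectorBasis i)) := by
  have h1 : M.trace =
      (star (hO.eigenvectorUnitary : Op d) * (M * (hO.eigenvectorUnitary : Op d))).trace := by
    rw [Matrix.trace_mul_comm, Matrix.mul_assoc, ← Unitary.coe_star, Unitary.coe_mul_star_self,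
      Matrix.mul_one]
  rw [h1, Matrix.trace]
  refine Finset.sum_congr rfl fun i _ => ?_
  rw [Matrix.diag, Matrix.mul_apply]
  simp only [dotProduct, Matrix.mulVec, Matrix.mul_apply, Matrix.star_apply,
    Matrix.IsHermitian.eigenvectorUnitary_apply, Pi.star_apply]

theorem norm_dotProduct_mulVec_le (X : Op d) (v : EuclideanSpace ℂ (Fin d)) :
    ‖dotProduct (star ⇑v) (X.mulVec ⇑v)‖ ≤ ‖X‖ * ‖v‖ ^ 2 := by
  have h1 : dotProduct (star ⇑v) (X.mulVec ⇑v) =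
      inner ℂ v (Matrix.toEuclideanCLM (n := Fin d) (𝕜 := ℂ) X v) := by
    rw [EuclideanSpace.inner_eq_star_dotProduct, dotProduct_comm, Matrix.ofLp_toEuclideanCLM]
  have h2 : ‖Matrix.toEuclideanCLM (n := Fin d) (𝕜 := ℂ) X v‖ ≤ ‖X‖ * ‖v‖ :=
    ContinuousLinearMap.le_opNorm _ _
  rw [h1]
  calc _ ≤ ‖v‖ * (‖X‖ * ‖v‖) := (norm_inner_le_norm _ _).trans (by gcongr)
    _ = _ := by ring

/-- A density operator is a functional of norm at most `1` for the operator norm. -/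
theorem norm_trace_density_mul_le {ρ : Op d} (hρ : IsDensity ρ) (X : Op d) :
    ‖(ρ * X).trace‖ ≤ ‖X‖ := by
  have hH := hρ.1.1
  have h1 : (ρ * X).trace = ∑ i, (hH.eigenvalues i : ℂ) *
      dotProduct (star ⇑(hH.eigenvectorBasis i)) (X.mulVec ⇑(hH.eigenvectorBasis i)) := by
    rw [Matrix.trace_mul_comm, trace_eq_sum_eigenvectorBasis hH]
    refine Finset.sum_congr rfl fun i _ => ?_
    rw [← Matrix.mulVec_mulVec, hH.mulVec_eigenvectorBasis, Matrix.mulVec_smul, dotProduct_smul]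
    simp
  have h2 : ∑ i, hH.eigenvalues i = 1 := by
    have h3 := hH.trace_eq_sum_eigenvalues
    rw [hρ.2] at h3
    have h4 : ((∑ i, hH.eigenvalues i : ℝ) : ℂ) = 1 := by rw [h3]; push_cast; rfl
    exact_mod_cast h4
  rw [h1]
  calc _ ≤ ∑ i, hH.eigenvalues i * ‖X‖ := by
        refine (norm_sum_le _ _).trans (Finset.sum_le_sum fun i _ => ?_)
        have h0 := hρ.1.eigenvalues_nonneg i
        rw [norm_mul, Complex.norm_real, Real.norm_of_nonneg h0]
        have h4 := norm_dotProduct_mulVec_le X (hH.eigenvectorBasis i)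
        rw [hH.eigenvectorBasis.orthonormal.1 i, one_pow, mul_one] at h4
        exact mul_le_mul_of_nonneg_left h4 h0
    _ = ‖X‖ := by rw [← Finset.sum_mul, h2, one_mul]

theorem isDensity_dilationStep {H : Op d} (hH : H.IsHermitian) (L : Fin J → Op d) {τ : ℝ}
    (hτ : 0 ≤ τ) {ρ : Op d} (hρ : IsDensity ρ) : IsDensity (dilationStep H L τ ρ) := by
  have hHer : (dilatedHamiltonian H L τ).IsHermitian := by
    rw [dilatedHamiltonian_eq H L hτ]; exact dilationPoly_isHermitian hH L _
  set E := NormedSpace.exp ((-Complex.I) • dilatedHamiltonian H L τ) with hE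
  have hstep : dilationStep H L τ ρ = traceAncilla (E * (ketBra (J := J) 0 0 ⊗ₖ ρ) * Eᴴ) := by
    rw [dilationStep, hE, ← conjTranspose_exp_smul hHer, Matrix.conjTranspose_conjTranspose]
  have hEE : Eᴴ * E = 1 := by
    rw [hE, ← conjTranspose_exp_smul hHer, Matrix.conjTranspose_conjTranspose,
      conjTranspose_exp_smul hHer, exp_smul_mul_exp_neg_smul]
  constructor
  · have hK : (ketBra (J := J) 0 0 ⊗ₖ ρ).PosSemidef := by
      refine Matrix.PosSemidef.kronecker ?_ hρ.1
      have : ketBra (J := J) 0 0 = (ketBra (J := J) 0 0)ᴴ * ketBra 0 0 := by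
        rw [conjTranspose_ketBra]; simp [ketBra]
      rw [this]
      exact Matrix.posSemidef_conjTranspose_mul_self _
    have hY := hK.mul_mul_conjTranspose_same E
    rw [hstep]
    have e : traceAncilla (E * (ketBra (J := J) 0 0 ⊗ₖ ρ) * Eᴴ) =
        ∑ a : Fin (J + 1), (E * (ketBra (J := J) 0 0 ⊗ₖ ρ) * Eᴴ).submatrix (fun i => (a, i))
          (fun i => (a, i)) := by
      ext i k
      simp [traceAncilla, Matrix.sum_apply]
    rw [e]
    exact Matrix.posSemidef_sum _ fun a _ => hY.submatrix _
  · have h1 := trace_traceAncilla_mul (E * (ketBra (J := J) 0 0 ⊗ₖ ρ) * Eᴴ) (1 : Op d)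
    rw [Matrix.one_kronecker_one, Matrix.mul_one, Matrix.mul_one] at h1
    rw [hstep, h1, Matrix.mul_assoc, Matrix.trace_mul_comm, Matrix.mul_assoc, hEE, Matrix.mul_one,
      Matrix.trace_kronecker, hρ.2]
    simp [ketBra]

theorem isDensity_simulatedState {H : Op d} (hH : H.IsHermitian) (L : Fin J → Op d) (T : ℝ)
    {ρ₀ : Op d} (hρ : IsDensity ρ₀) (k : ℕ) : IsDensity (simulatedState H L T ρ₀ k) := by
  have hTH : ((T : ℂ) • H).IsHermitian := by
    rw [Matrix.IsHermitian, Matrix.conjTranspose_smul, hH.eq]; simp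
  unfold simulatedState
  generalize hτ : (1 / (k : ℝ)) = τ
  have hτ0 : 0 ≤ τ := by rw [← hτ]; positivity
  clear hτ
  induction k with
  | zero => exact hρ
  | succ k ih =>
    rw [Function.iterate_succ_apply']
    exact isDensity_dilationStep hTH _ hτ0 ih

/-! ### Analyticity in the step size -/

/-- The simulated expectation value, as a function of the step size `τ = 1/k`, is the restriction of
an analytic function of `τ` that is bounded by `e ‖O‖` on the disc `|τ| ≤ 1 / (4 e⁴ Λ)²`, and whose
value at `0` is the exact expectation value; `c` is the sequence of its Taylor coefficients. -/
theorem exists_taylor_simulated {H : Op d} (hH : H.IsHermitian) (L : Fin J → Op d) {Λ : ℝ}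
    (hΛ : 1 ≤ Λ) (hgs : generatorSize H L ≤ Λ) {ρ₀ : Op d} (hρ : IsDensity ρ₀) (O : Op d) :
    ∃ c : ℕ → ℂ, c 0 = (ρ₀ * NormedSpace.exp (dualLindbladian H L) O).trace ∧
      ∀ n k : ℕ, 0 < k → (4 * Real.exp 4 * Λ) ^ 2 * (1 / (k : ℝ)) < 1 →
        ‖((dilationStep H L (1 / (k : ℝ)))^[k] ρ₀ * O).trace -
            ∑ m ∈ Finset.range n, ((1 / (k : ℝ) : ℝ) : ℂ) ^ m * c m‖ ≤
          ‖O‖ * Real.exp 1 * ((4 * Real.exp 4 * Λ) ^ 2 * (1 / (k : ℝ))) ^ n /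
            (1 - (4 * Real.exp 4 * Λ) ^ 2 * (1 / (k : ℝ))) := by
  -- unit trace excludes `d = 0`, so that the identity has norm `1`
  have hd : Nonempty (Fin d) := by
    by_contra h
    rw [not_nonempty_iff] at h
    have := hρ.2
    simp [Matrix.trace] at this
  have hΛ0 : 0 < Λ := by linarith
  have he : 1 ≤ Real.exp 4 := Real.one_le_exp (by norm_num)
  set F := heisenbergStep H L with hF
  set A := dualLindbladian H L with hAdef
  have hFd : Differentiable ℂ F := differentiable_heisenbergStep H L
  have heven : ∀ x, F (-x) = F x := heisenbergStep_neg H L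
  have hF0 : F 0 = 1 := heisenbergStep_zero H L
  have hbd : ∀ x : ℂ, ‖x‖ ^ 2 * Λ ≤ 1 → ‖F x‖ ≤ Real.exp 4 := fun x hx =>
    norm_heisenbergStep_le_exp hgs hx
  have hA := heisenbergStep_expansion H L
  have hcontr : ∀ t : ℝ, ‖F t‖ ≤ 1 := norm_heisenbergStep_ofReal_le hH L
  set g : ℂ → ℂ := fun x => (ρ₀ * NormedSpace.exp (effectiveGenerator F A x) O).trace with hg
  set r := 1 / (4 * Real.exp 4 * Λ) with hr
  have hr0 : 0 < r := by positivity
  set ℓ : (Op d →L[ℂ] Op d) →L[ℂ] ℂ := LinearMap.toContinuousLinearMap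
    ((Matrix.traceLinearMap (Fin d) ℂ ℂ) ∘ₗ (LinearMap.mulLeft ℂ ρ₀) ∘ₗ
      (ContinuousLinearMap.apply ℂ (Op d) O : (Op d →L[ℂ] Op d) →ₗ[ℂ] Op d)) with hℓ
  have hgℓ : ∀ x, g x = ℓ (NormedSpace.exp (effectiveGenerator F A x)) := fun x => rfl
  have hgd : DiffContOnCl ℂ g (Metric.ball 0 r) := by
    have h1 := differentiableOn_exp_effectiveGenerator hΛ hFd heven hF0 hbd hA
    have h2 : DifferentiableOn ℂ g (Metric.ball 0 (2 / (4 * Real.exp 4 * Λ))) :=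
      Differentiable.comp_differentiableOn (g := ℓ) ℓ.differentiable h1
    refine DifferentiableOn.diffContOnCl (h2.mono ?_)
    rw [closure_ball _ hr0.ne']
    refine Metric.closedBall_subset_ball ?_
    rw [hr]
    gcongr
    norm_num
  have hgb : ∀ z ∈ Metric.sphere (0 : ℂ) r, ‖g z‖ ≤ ‖O‖ * Real.exp 1 := by
    intro z hz
    have hz' : ‖z‖ = r := by simpa using hz
    have h1 := norm_exp_effectiveGenerator_le hΛ hFd heven hF0 hbd hA hcontr (x := z) (by
      rw [hz', hr, mul_one_div_cancel (by positivity)])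
    refine (norm_trace_density_mul_le hρ _).trans ?_
    rw [mul_comm]
    exact ContinuousLinearMap.le_of_opNorm_le _ h1 O
  have hge : ∀ z, g (-z) = g z := fun z => by
    rw [hgℓ, hgℓ, effectiveGenerator_neg heven]
  obtain ⟨c, hc0, hc⟩ := exists_even_taylor hr0 hgd hgb hge
  refine ⟨c, ?_, ?_⟩
  · rw [hc0, hg]
    simp only [effectiveGenerator, if_true]
  · intro n k hk hkΛ
    have hk0 : (0 : ℝ) ≤ 1 / (k : ℝ) := by positivity
    set x : ℂ := ((Real.sqrt (1 / (k : ℝ)) : ℝ) : ℂ) with hx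
    have hx2 : x ^ 2 = ((1 / (k : ℝ) : ℝ) : ℂ) := by
      rw [hx, ← Complex.ofReal_pow, Real.sq_sqrt hk0]
    have hxn : ‖x‖ ^ 2 = 1 / (k : ℝ) := by
      rw [hx, Complex.norm_real, Real.norm_of_nonneg (Real.sqrt_nonneg _), Real.sq_sqrt hk0]
    have hq : (‖x‖ / r) ^ 2 = (4 * Real.exp 4 * Λ) ^ 2 * (1 / (k : ℝ)) := by
      rw [div_pow, hxn, hr]; field_simp
    have hxr : ‖x‖ < r := by
      rw [← hq] at hkΛ
      have h1 : ‖x‖ / r < 1 := by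
        by_contra! h
        nlinarith
      rwa [div_lt_one hr0] at h1
    have hgx : g x = ((dilationStep H L (1 / (k : ℝ)))^[k] ρ₀ * O).trace := by
      rw [trace_iterate_dilationStep_mul H L hk0, hg]
      simp only
      rw [exp_effectiveGenerator_eq_pow hk (by rw [hx2]; push_cast; rfl)]
      have h2 : 16 * (‖x‖ ^ 2 * Λ) * Real.exp 4 < 1 := by
        rw [hxn]
        calc 16 * (1 / (k : ℝ) * Λ) * Real.exp 4 ≤ 16 * (1 / (k : ℝ) * Λ ^ 2) * Real.exp 4 ^ 2 := by
              gcongr <;> nlinarith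
          _ = (4 * Real.exp 4 * Λ) ^ 2 * (1 / (k : ℝ)) := by ring
          _ < 1 := hkΛ
      have h3 : 0 ≤ ‖x‖ ^ 2 * Λ := by positivity
      have h1 := (even_family_expansion hΛ0 hFd heven hF0 hbd hA (x := x) (by nlinarith)).1
      nlinarith
    have h := hc n x hxr
    rw [hq, hgx] at h
    refine le_trans (le_of_eq ?_) h
    congr 2
    refine Finset.sum_congr rfl fun m _ => ?_
    rw [pow_mul, hx2, smul_eq_mul]

end Evolution

/-! ### Shot noise -/

section Shots
open scoped Matrix Matrix.Norms.L2Operator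
open MeasureTheory ProbabilityTheory

theorem shotWeight_nonneg {d : ℕ} {ρ : Op d} (hρ : IsDensity ρ) (v : Fin d → ℂ) :
    0 ≤ (dotProduct (star v) (ρ.mulVec v)).re := hρ.1.re_dotProduct_nonneg v

theorem isProbabilityMeasure_shotLaw {d : ℕ} {O : Op d} (hO : O.IsHermitian) {ρ : Op d}
    (hρ : IsDensity ρ) : IsProbabilityMeasure (shotLaw hO ρ) := by
  constructor
  rw [shotLaw, Measure.finsetSum_apply]
  simp only [Measure.smul_apply, measure_univ, smul_eq_mul, mul_one]
  rw [← ENNReal.ofReal_sum_of_nonneg fun i _ => shotWeight_nonneg hρ _, ← Complex.re_sum,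
    ← trace_eq_sum_eigenvectorBasis hO, hρ.2]
  simp

theorem eigenvalues_eq_dotProduct {d : ℕ} {O : Op d} (hO : O.IsHermitian) (i : Fin d) :
    (hO.eigenvalues i : ℂ) =
      dotProduct (star ⇑(hO.eigenvectorBasis i)) (O.mulVec ⇑(hO.eigenvectorBasis i)) := by
  have h1 : dotProduct (star ⇑(hO.eigenvectorBasis i)) ⇑(hO.eigenvectorBasis i) = 1 := by
    have h2 := EuclideanSpace.inner_eq_star_dotProduct (hO.eigenvectorBasis i)
      (hO.eigenvectorBasis i)
    rw [dotProduct_comm, ← h2, inner_self_eq_norm_sq_to_K, hO.eigenvectorBasis.orthonormal.1 i]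
    simp
  rw [hO.mulVec_eigenvectorBasis, dotProduct_smul, h1]
  simp

theorem abs_eigenvalues_le {d : ℕ} {O : Op d} (hO : O.IsHermitian) (i : Fin d) :
    |hO.eigenvalues i| ≤ ‖O‖ := by
  have h := norm_dotProduct_mulVec_le O (hO.eigenvectorBasis i)
  rwa [← eigenvalues_eq_dotProduct hO, hO.eigenvectorBasis.orthonormal.1 i, one_pow, mul_one,
    Complex.norm_real, Real.norm_eq_abs] at h

theorem ae_shotLaw_mem {d : ℕ} {O : Op d} (hO : O.IsHermitian) (ρ : Op d) {M : ℝ} (hM : ‖O‖ ≤ M) :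
    ∀ᵐ y ∂(shotLaw hO ρ), y ∈ Set.Icc (-M) M := by
  rw [ae_iff, shotLaw, Measure.finsetSum_apply]
  refine Finset.sum_eq_zero fun i _ => ?_
  have h := abs_le.mp ((abs_eigenvalues_le hO i).trans hM)
  have hms : MeasurableSet {y : ℝ | ¬ y ∈ Set.Icc (-M) M} := measurableSet_Icc.compl
  rw [Measure.smul_apply, Measure.dirac_apply' _ hms, Set.indicator_of_notMem, smul_zero]
  simpa using h

/-- Shots are unbiased. -/
theorem integral_shotLaw {d : ℕ} {O : Op d} (hO : O.IsHermitian) {ρ : Op d} (hρ : IsDensity ρ) :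
    ∫ y, y ∂(shotLaw hO ρ) = ((ρ * O).trace).re := by
  rw [shotLaw, integral_finsetSum_measure fun i _ =>
    (integrable_dirac (by simp)).smul_measure ENNReal.ofReal_ne_top]
  simp only [integral_smul_measure, integral_dirac]
  rw [trace_eq_sum_eigenvectorBasis hO, Complex.re_sum]
  refine Finset.sum_congr rfl fun i _ => ?_
  rw [ENNReal.toReal_ofReal (shotWeight_nonneg hρ _), ← Matrix.mulVec_mulVec,
    hO.mulVec_eigenvectorBasis, Matrix.mulVec_smul, dotProduct_smul, Complex.real_smul,
    Complex.re_ofReal_mul, smul_eq_mul, mul_comm]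

theorem measureReal_weighted_sum_ge_le {ι : Type*} [Fintype ι] {μ : ι → Measure ℝ}
    [∀ i, IsProbabilityMeasure (μ i)] {M : ℝ} (hμ : ∀ i, ∀ᵐ y ∂(μ i), y ∈ Set.Icc (-M) M)
    (w : ι → ℝ) {ε : ℝ} (hε : 0 ≤ ε) :
    (Measure.pi μ).real {ω | ε ≤ ∑ i, w i * (ω i - ∫ y, y ∂(μ i))} ≤
      Real.exp (-ε ^ 2 / (2 * (M ^ 2 * ∑ i, w i ^ 2))) := by
  have hind : iIndepFun (fun i (ω : ι → ℝ) => w i * (ω i - ∫ y, y ∂(μ i))) (Measure.pi μ) :=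
    iIndepFun_pi (X := fun i y => w i * (y - ∫ y, y ∂(μ i)))
      fun i => ((measurable_id.sub_const _).const_mul _).aemeasurable
  have hsub : ∀ i ∈ Finset.univ, HasSubgaussianMGF (fun ω : ι → ℝ => w i * (ω i - ∫ y, y ∂(μ i)))
      (Real.toNNReal (M ^ 2 * w i ^ 2)) (Measure.pi μ) := by
    intro i _
    have h1 := (hasSubgaussianMGF_of_mem_Icc (X := fun y : ℝ => y) aemeasurable_id (hμ i)).const_mul
      (w i)
    rw [← (measurePreserving_eval μ i).map_eq] at h1
    have h2 := h1.of_map (measurable_pi_apply (X := fun _ => ℝ) i).aemeasurable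
    rw [(measurePreserving_eval μ i).map_eq] at h2
    convert h2 using 1
    · rfl
    · refine NNReal.eq ?_
      rw [Real.coe_toNNReal _ (by positivity)]
      change M ^ 2 * w i ^ 2 = w i ^ 2 * (‖M - -M‖ / 2) ^ 2
      have : ‖M - -M‖ / 2 = |M| := by
        rw [sub_neg_eq_add, Real.norm_eq_abs, ← two_mul, abs_mul, abs_two]; ring
      rw [this, sq_abs, mul_comm]
  have h := HasSubgaussianMGF.measure_sum_ge_le_of_iIndepFun hind hsub hε
  refine h.trans (le_of_eq ?_)
  congr 3
  push_cast
  rw [Finset.mul_sum]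
  exact Finset.sum_congr rfl fun i _ => Real.coe_toNNReal _ (by positivity)

/-- Hoeffding's inequality, two-sided, for a weighted sum of independent variables with values in
`[-M, M]`. -/
theorem measureReal_abs_weighted_sum_ge_le {ι : Type*} [Fintype ι] {μ : ι → Measure ℝ}
    [∀ i, IsProbabilityMeasure (μ i)] {M : ℝ} (hμ : ∀ i, ∀ᵐ y ∂(μ i), y ∈ Set.Icc (-M) M)
    (w : ι → ℝ) {ε : ℝ} (hε : 0 ≤ ε) :
    (Measure.pi μ).real {ω | ε ≤ |∑ i, w i * (ω i - ∫ y, y ∂(μ i))|} ≤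
      2 * Real.exp (-ε ^ 2 / (2 * (M ^ 2 * ∑ i, w i ^ 2))) := by
  have h1 := measureReal_weighted_sum_ge_le hμ w hε
  have h2 := measureReal_weighted_sum_ge_le hμ (fun i => -w i) hε
  simp only [neg_mul, Finset.sum_neg_distrib, neg_sq] at h2
  have h3 : {ω : ι → ℝ | ε ≤ |∑ i, w i * (ω i - ∫ y, y ∂(μ i))|} ⊆
      {ω | ε ≤ ∑ i, w i * (ω i - ∫ y, y ∂(μ i))} ∪
        {ω | ε ≤ -∑ i, w i * (ω i - ∫ y, y ∂(μ i))} := fun ω hω => by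
    simpa only [Set.mem_union, Set.mem_ofPred_eq] using le_abs.mp hω
  have h4 := (measureReal_mono (μ := Measure.pi μ) h3).trans (measureReal_union_le _ _)
  linarith

/-- Accuracy of the extrapolated estimate, given a bound `V` on the sum of the squared weights and a
bound `ε / 2` on the bias. -/
theorem experiment_accuracy {d J : ℕ} {H : Op d} (hH : H.IsHermitian) (L : Fin J → Op d) (T : ℝ)
    {ρ₀ : Op d} (hρ : IsDensity ρ₀) {O : Op d} (hO : O.IsHermitian) {M : ℝ} (hM0 : 0 < M)
    (hM : ‖O‖ ≤ M) (a : ℝ) (n : ℕ) {V : ℝ}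
    (hV0 : 0 < ∑ j, extrapolationWeight (node a n) j ^ 2)
    (hV : ∑ j, extrapolationWeight (node a n) j ^ 2 ≤ V) {y ε δ : ℝ} (hε : 0 < ε)
    (hbias : |∑ j, extrapolationWeight (node a n) j *
      ((simulatedState H L T ρ₀ (stepCount a n j) * O).trace).re - y| ≤ ε / 2)
    (hδ : 0 < δ) (hδ1 : δ < 1) {N : ℕ}
    (hN : 16 * M ^ 2 * V * (1 / ε ^ 2) * Real.log (2 / δ) ≤ N) :
    1 - δ < (experimentLaw H L T ρ₀ hO a n N).real
      {ω | |extrapolatedEstimate a n N ω - y| < ε} := by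
  set W := extrapolationWeight (node a n) with hW
  set μ : Fin (n + 1) × Fin N → Measure ℝ := fun p =>
    shotLaw hO (simulatedState H L T ρ₀ (stepCount a n p.1)) with hμ
  have hdens := fun k => isDensity_simulatedState hH L T hρ k
  have hprob : ∀ p, IsProbabilityMeasure (μ p) := fun p =>
    isProbabilityMeasure_shotLaw hO (hdens _)
  have hlog : 0 < Real.log (2 / δ) := Real.log_pos (by rw [lt_div_iff₀ hδ]; linarith)
  have hVpos : 0 < V := hV0.trans_le hV
  have hNpos : (0 : ℝ) < N := lt_of_lt_of_le (by positivity) hN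
  have hlaw : experimentLaw H L T ρ₀ hO a n N = Measure.pi μ := rfl
  rw [hlaw]
  have hae : ∀ p, ∀ᵐ y ∂(μ p), y ∈ Set.Icc (-M) M := fun p => ae_shotLaw_mem hO _ hM
  have hmean : ∀ p, ∫ y, y ∂(μ p) =
      ((simulatedState H L T ρ₀ (stepCount a n p.1) * O).trace).re := fun p =>
    integral_shotLaw hO (hdens _)
  have hH := measureReal_abs_weighted_sum_ge_le hae (fun p => W p.1 / N) (half_pos hε).le
  have hsumsq : ∑ p : Fin (n + 1) × Fin N, (W p.1 / N) ^ 2 = (∑ j, W j ^ 2) / N := by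
    rw [Fintype.sum_prod_type]
    simp only [Finset.sum_const, Finset.card_univ, Fintype.card_fin, nsmul_eq_mul]
    rw [Finset.sum_div]
    refine Finset.sum_congr rfl fun j _ => ?_
    field_simp
  have hnoise : ∀ ω : Fin (n + 1) × Fin N → ℝ,
      ∑ p, W p.1 / N * (ω p - ∫ y, y ∂(μ p)) = extrapolatedEstimate a n N ω -
        ∑ j, W j * ((simulatedState H L T ρ₀ (stepCount a n j) * O).trace).re := by
    intro ω
    rw [extrapolatedEstimate, richardson_eq_sum, ← hW, ← Finset.sum_sub_distrib,
      Fintype.sum_prod_type]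
    refine Finset.sum_congr rfl fun j _ => ?_
    simp only [hmean]
    rw [← Finset.mul_sum, Finset.sum_sub_distrib, Finset.sum_const, Finset.card_univ,
      Fintype.card_fin, nsmul_eq_mul]
    field_simp
  simp only [hnoise] at hH
  -- the factor `2` of the two-sided bound is absorbed by `2 (δ / 2)² < δ`
  have htail : 2 * Real.exp (-(ε / 2) ^ 2 /
      (2 * (M ^ 2 * ∑ p : Fin (n + 1) × Fin N, (W p.1 / N) ^ 2))) < δ := by
    rw [hsumsq]
    have h1 : 2 * Real.log (2 / δ) ≤ (ε / 2) ^ 2 / (2 * (M ^ 2 * ((∑ j, W j ^ 2) / N))) := by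
      calc 2 * Real.log (2 / δ) = (16 * M ^ 2 * V * (1 / ε ^ 2) * Real.log (2 / δ)) *
            (ε ^ 2 / (8 * M ^ 2 * V)) := by field_simp; norm_num
        _ ≤ N * (ε ^ 2 / (8 * M ^ 2 * V)) := by gcongr
        _ = (ε / 2) ^ 2 / (2 * (M ^ 2 * (V / N))) := by field_simp; norm_num
        _ ≤ _ := by gcongr
    have h2 : Real.exp (-(ε / 2) ^ 2 / (2 * (M ^ 2 * ((∑ j, W j ^ 2) / N)))) ≤ (δ / 2) ^ 2 := by
      rw [neg_div]
      calc _ ≤ Real.exp (-(2 * Real.log (2 / δ))) := Real.exp_le_exp.mpr (by linarith)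
        _ = (δ / 2) ^ 2 := by
          have h3 : -(2 * Real.log (2 / δ)) = Real.log (δ / 2) + Real.log (δ / 2) := by
            rw [← inv_div δ 2, Real.log_inv]; ring
          rw [h3, Real.exp_add, Real.exp_log (by positivity), sq]
    nlinarith
  -- the total error is below `ε` unless the fluctuation is at least `ε / 2`
  have hcover : (Set.univ : Set (Fin (n + 1) × Fin N → ℝ)) ⊆
      {ω | |extrapolatedEstimate a n N ω - y| < ε} ∪
      {ω | ε / 2 ≤ |extrapolatedEstimate a n N ω -
        ∑ j, W j * ((simulatedState H L T ρ₀ (stepCount a n j) * O).trace).re|} := by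
    intro ω _
    by_cases h : ε / 2 ≤ |extrapolatedEstimate a n N ω -
        ∑ j, W j * ((simulatedState H L T ρ₀ (stepCount a n j) * O).trace).re|
    · exact Or.inr h
    · refine Or.inl ?_
      push Not at h
      have h5 := abs_sub_le (extrapolatedEstimate a n N ω)
        (∑ j, W j * ((simulatedState H L T ρ₀ (stepCount a n j) * O).trace).re) y
      exact lt_of_le_of_lt h5 (by linarith)
  have h6 := (measureReal_mono (μ := Measure.pi μ) hcover).trans (measureReal_union_le _ _)
  rw [probReal_univ] at h6
  linarith

end Shots

/-! ### Bias, separation of the nodes and depth -/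

section Bias
open scoped Matrix Matrix.Norms.L2Operator

/-- The bias of Richardson extrapolation is exponentially small in the number of nodes as soon as
the extrapolation interval has length `≲ 1 / Λ ^ 2`: the interpolation weights reproduce the
Taylor polynomial of degree `n` at `0` exactly, and the Taylor remainders are geometrically
small. -/
theorem abs_bias_le {d J : ℕ} {H : Op d} (hH : H.IsHermitian) (L : Fin J → Op d) {T Λ : ℝ}
    (hT : 0 < T) (hΛ : 1 ≤ Λ) (hgs : T * generatorSize H L ≤ Λ) {ρ₀ : Op d} (hρ₀ : IsDensity ρ₀)
    {ρ : ℝ → Op d} (hρ : IsLindbladSolution H L T ρ₀ ρ) {O : Op d} {M : ℝ} (hM : ‖O‖ ≤ M)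
    {a : ℝ} (ha : 0 < a) {n : ℕ} (hn : a * ((n : ℝ) + 1) ^ 2 ≤ 1 / 2)
    (hq : (4 * Real.exp 4 * Λ) ^ 2 * a ≤ Real.exp (-2)) :
    |∑ j, extrapolationWeight (node a n) j *
      ((simulatedState H L T ρ₀ (stepCount a n j) * O).trace).re - ((ρ T * O).trace).re| ≤
      4 * Real.exp 6 * M * Real.exp (-((n : ℝ) + 1)) := by
  have hM0 : 0 ≤ M := (norm_nonneg O).trans hM
  have hHT : ((T : ℂ) • H).IsHermitian := by
    rw [Matrix.IsHermitian, Matrix.conjTranspose_smul, hH.eq]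
    simp
  obtain ⟨c, hc0, hc⟩ := exists_taylor_simulated hHT (fun j => ((Real.sqrt T : ℝ) : ℂ) • L j) hΛ
    ((generatorSize_smul H L hT.le).trans_le hgs) hρ₀ O
  rw [dualLindbladian_smul H L hT.le, ← trace_solution_mul hT hρ O] at hc0
  set Q := (4 * Real.exp 4 * Λ) ^ 2 with hQ
  set w := extrapolationWeight (node a n) with hw
  set f : Fin (n + 1) → ℂ := fun j => (simulatedState H L T ρ₀ (stepCount a n j) * O).trace with hf
  set P : Fin (n + 1) → ℂ := fun j => ∑ m ∈ Finset.range (n + 1), ((node a n j : ℝ) : ℂ) ^ m * c m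
    with hP
  have hQ0 : 0 ≤ Q := by positivity
  have hhalf : Real.exp (-2) ≤ 1 / 2 := by
    rw [Real.exp_neg, ← one_div]
    exact one_div_le_one_div_of_le two_pos (by linarith [Real.add_one_le_exp 2])
  have hterm : ∀ j, ‖f j - P j‖ ≤ 2 * Real.exp 1 * M * Real.exp (-2) ^ (n + 1) := by
    intro j
    have hτ : Q * node a n j ≤ Real.exp (-2) :=
      (mul_le_mul_of_nonneg_left (node_lt ha n j).le hQ0).trans hq
    have hτ0 : 0 ≤ Q * node a n j := mul_nonneg hQ0 (node_pos ha n j).le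
    refine (hc (n + 1) (stepCount a n j) (stepCount_pos ha n j)
      (show Q * node a n j < 1 by linarith)).trans ?_
    change ‖O‖ * Real.exp 1 * (Q * node a n j) ^ (n + 1) / (1 - Q * node a n j) ≤ _
    rw [div_le_iff₀ (by linarith)]
    calc ‖O‖ * Real.exp 1 * (Q * node a n j) ^ (n + 1)
        ≤ M * Real.exp 1 * Real.exp (-2) ^ (n + 1) := by gcongr
      _ = 2 * Real.exp 1 * M * Real.exp (-2) ^ (n + 1) * (1 / 2) := by ring
      _ ≤ _ := by gcongr; linarith
  have hexact : ∑ j, (w j : ℂ) * P j = (ρ T * O).trace := by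
    have h1 : ∀ m ∈ Finset.range (n + 1),
        ∑ j, (w j : ℂ) * (((node a n j : ℝ) : ℂ) ^ m * c m) = (0 : ℂ) ^ m * c m := by
      intro m hm
      have h2 := sum_extrapolationWeight_mul_pow (node_strictMono ha hn).injective
        (Finset.mem_range_succ_iff.mp hm)
      have h3 : ∑ j, (w j : ℂ) * ((node a n j : ℝ) : ℂ) ^ m = (0 : ℂ) ^ m := by
        exact_mod_cast congrArg (fun x : ℝ => (x : ℂ)) h2
      rw [← h3, Finset.sum_mul]
      exact Finset.sum_congr rfl fun j _ => by ring
    simp only [hP, Finset.mul_sum]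
    rw [Finset.sum_comm, Finset.sum_congr rfl h1, Finset.sum_range_succ', Finset.sum_eq_zero]
    · simp [hc0]
    · intro m _
      simp
  have hre : ∑ j, w j * (f j).re - ((ρ T * O).trace).re = (∑ j, (w j : ℂ) * (f j - P j)).re := by
    simp only [mul_sub, Finset.sum_sub_distrib]
    rw [hexact, Complex.sub_re, Complex.re_sum]
    simp only [Complex.re_ofReal_mul]
  rw [hre]
  calc |(∑ j, (w j : ℂ) * (f j - P j)).re| ≤ ‖∑ j, (w j : ℂ) * (f j - P j)‖ :=
        Complex.abs_re_le_norm _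
    _ ≤ ∑ j, |w j| * (2 * Real.exp 1 * M * Real.exp (-2) ^ (n + 1)) := by
        refine (norm_sum_le _ _).trans (Finset.sum_le_sum fun j _ => ?_)
        rw [norm_mul, Complex.norm_real, Real.norm_eq_abs]
        exact mul_le_mul_of_nonneg_left (hterm j) (abs_nonneg _)
    _ ≤ 2 * Real.exp 5 * ((n : ℝ) + 1) * (2 * Real.exp 1 * M * Real.exp (-2) ^ (n + 1)) := by
        rw [← Finset.sum_mul]
        gcongr
        exact sum_abs_extrapolationWeight_node_le ha hn
    _ ≤ 2 * Real.exp 5 * Real.exp ((n : ℝ) + 1) *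
          (2 * Real.exp 1 * M * Real.exp (-2) ^ (n + 1)) := by
        gcongr
        linarith [Real.add_one_le_exp ((n : ℝ) + 1)]
    _ = 4 * (Real.exp 5 * Real.exp 1) * M *
          (Real.exp ((n : ℝ) + 1) * Real.exp (-2) ^ (n + 1)) := by ring
    _ = 4 * Real.exp 6 * M * Real.exp (-((n : ℝ) + 1)) := by
        rw [← Real.exp_add, ← Real.exp_nat_mul, ← Real.exp_add]
        push_cast
        ring_nf

/-- The lower bound on the simulation time, in the form in which it enters. The factor `g` takes
care of the range where `log log (1 / ε) < 1`, in which the lower bound on `T` says little. -/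
theorem sq_mul_le_of_time_ge {l₀ l T x g : ℝ} (hl₀ : 1 < l₀) (hl : l₀ ≤ l) (hT : 1 ≤ T)
    (hx : 1 ≤ x) (hg0 : 0 ≤ g) (hg1 : g ≤ 1) (hg2 : g ≤ Real.log l₀)
    (h : x * Real.sqrt (Real.log x) / (l * Real.sqrt (Real.log l)) ≤ T) :
    x ^ 2 * g ≤ Real.exp 1 ^ 2 * ((l * T) ^ 2 * Real.log l) := by
  have hloglog : Real.log l₀ ≤ Real.log l := Real.log_le_log (by linarith) hl
  have hlog : 0 < Real.log l := (Real.log_pos hl₀).trans_le hloglog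
  have hl0 : 0 < l := by linarith
  have he : 1 ≤ Real.exp 1 ^ 2 := one_le_pow₀ (Real.one_le_exp zero_le_one)
  rcases le_or_gt (Real.exp 1) x with hy | hy
  · have hy1 : 1 ≤ Real.log x := (Real.le_log_iff_exp_le (by linarith)).mpr hy
    rw [div_le_iff₀ (by positivity)] at h
    have h1 : x ≤ T * (l * Real.sqrt (Real.log l)) :=
      (le_mul_of_one_le_right (by linarith) (Real.one_le_sqrt.mpr hy1)).trans h
    have h2 : x ^ 2 ≤ (l * T) ^ 2 * Real.log l := by
      calc x ^ 2 ≤ (T * (l * Real.sqrt (Real.log l))) ^ 2 := by gcongr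
        _ = (l * T) ^ 2 * Real.sqrt (Real.log l) ^ 2 := by ring
        _ = _ := by rw [Real.sq_sqrt hlog.le]
    calc x ^ 2 * g ≤ x ^ 2 * 1 := by gcongr
      _ ≤ 1 * ((l * T) ^ 2 * Real.log l) := by linarith
      _ ≤ _ := by gcongr
  · have hlT : 1 ≤ l * T := one_le_mul_of_one_le_of_one_le (by linarith) hT
    calc x ^ 2 * g ≤ Real.exp 1 ^ 2 * (1 ^ 2 * Real.log l) := by
          gcongr
          rw [one_pow, one_mul]
          exact hg2.trans hloglog
      _ ≤ _ := by gcongr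

/-- The interval is short enough for the perturbed nodes to be well separated. -/
theorem interval_mul_sq_le {a x B n : ℝ} (ha : 0 < a) (hn : Real.exp 4 ≤ n)
    (hx : 0 ≤ x) (hax : a * (max B 1 * x) ^ 2 ≤ 1 / 8)
    (h : n ≤ B * x ∨ 2 * a * n ^ 2 * Real.log n < 1) : a * (n + 1) ^ 2 ≤ 1 / 2 := by
  have hn1 : 1 ≤ n := (Real.one_le_exp (by norm_num)).trans hn
  have key : a * n ^ 2 ≤ 1 / 8 := by
    rcases h with h | h
    · have : n ≤ max B 1 * x := h.trans (mul_le_mul_of_nonneg_right (le_max_left _ _) hx)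
      exact (by gcongr : a * n ^ 2 ≤ a * (max B 1 * x) ^ 2).trans hax
    · have hlog : 4 ≤ Real.log n := (Real.le_log_iff_exp_le (by linarith)).mpr hn
      have : 2 * a * n ^ 2 * 4 ≤ 2 * a * n ^ 2 * Real.log n := by gcongr
      linarith
  calc a * (n + 1) ^ 2 ≤ a * (2 * n) ^ 2 := by gcongr; linarith
    _ ≤ 1 / 2 := by linarith

theorem sq_div_le_maxDepth {a : ℝ} (ha : 0 < a) {n : ℕ} (hn : a * ((n : ℝ) + 1) ^ 2 ≤ 1 / 2) :
    (n : ℝ) ^ 2 / a ≤ maxDepth a n := by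
  rw [maxDepth_eq ha hn]
  refine le_trans ?_ (le_stepCount a n 0)
  rw [div_le_div_iff₀ ha (chebNode_pos ha n 0), one_mul]
  have h := chebNode_zero_le ha.le n
  rw [le_div_iff₀ (by positivity)] at h
  refine le_trans ?_ h
  rw [mul_comm]
  have := (chebNode_pos ha n 0).le
  gcongr
  linarith

theorem maxDepth_le_sq_div {a : ℝ} (ha : 0 < a) {n : ℕ} (hn : a * ((n : ℝ) + 1) ^ 2 ≤ 1 / 2)
    (hn1 : 1 ≤ n) : (maxDepth a n : ℝ) ≤ 32 * (n : ℝ) ^ 2 / a := by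
  rw [maxDepth_eq ha hn]
  have hn1' : (1 : ℝ) ≤ n := by exact_mod_cast hn1
  have hpos := chebNode_pos ha n 0
  have ha1 : a ≤ 1 := by nlinarith
  have h1 : 1 ≤ 1 / chebNode a n 0 :=
    (one_le_div hpos).mpr ((chebNode_lt ha n 0).le.trans ha1)
  have h2 : 1 / chebNode a n 0 ≤ 4 * ((n : ℝ) + 1) ^ 2 / a := by
    have h3 := chebNode_zero_ge ha.le n
    rw [div_le_div_iff₀ hpos ha, one_mul]
    rwa [div_le_iff₀ (by positivity), mul_comm] at h3
  have h4 := (stepCount_lt ha n 0).le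
  calc (stepCount a n 0 : ℝ) ≤ 2 * (4 * ((n : ℝ) + 1) ^ 2 / a) := by linarith
    _ ≤ 2 * (4 * (2 * (n : ℝ)) ^ 2 / a) := by gcongr; linarith
    _ = _ := by ring

theorem sum_sq_extrapolationWeight_pos {n : ℕ} {τ : Fin (n + 1) → ℝ}
    (hτ : Function.Injective τ) : 0 < ∑ j, extrapolationWeight τ j ^ 2 := by
  refine (Finset.sum_nonneg fun j _ => sq_nonneg _).lt_of_ne fun h => ?_
  have h1 := (Finset.sum_eq_zero_iff_of_nonneg fun j _ => sq_nonneg _).mp h.symm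
  have h2 := sum_extrapolationWeight_mul_pow hτ (Nat.zero_le n)
  rw [Finset.sum_eq_zero fun j hj => by rw [pow_eq_zero_iff two_ne_zero |>.mp (h1 j hj), zero_mul]]
    at h2
  simp at h2

end Bias

theorem mainTheorem2 (l₀ M : ℝ) (hl₀ : 1 < l₀) (hM : 0 < M) :
    ∃ A : ℝ, 0 < A ∧ ∀ B : ℝ,
      ∃ c CN c₁ C₂ : ℝ, 0 < c ∧ c ≤ 1 ∧ 0 < CN ∧ 0 < c₁ ∧ 0 < C₂ ∧
        ∀ (d J : ℕ) (H : Op d) (L : Fin J → Op d) (O ρ₀ : Op d) (ρ : ℝ → Op d)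
          (l T ε a : ℝ) (hO : O.IsHermitian),
          H.IsHermitian → opNorm O ≤ M → IsDensity ρ₀ →
          generatorSize H L ≤ l → l₀ ≤ l → 1 ≤ T →
          IsLindbladSolution H L T ρ₀ ρ →
          0 < ε → ε ≤ Real.exp (-1) →
          Real.log (1 / ε) * Real.sqrt (Real.log (Real.log (1 / ε))) /
            (l * Real.sqrt (Real.log l)) ≤ T →
          a = c / ((l * T) ^ 2 * Real.log l) →
          ∀ n : ℕ, A * Real.log (1 / ε) ≤ (n : ℝ) →
            ((n : ℝ) ≤ B * Real.log (1 / ε) ∨ 2 * a * (n : ℝ) ^ 2 * Real.log n < 1) →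
            -- the step sizes are distinct and lie in the extrapolation interval
            (StrictMono (node a n) ∧ ∀ j, 0 < node a n j ∧ node a n j < a) ∧
            -- accuracy with high probability
            (∀ (δ : ℝ) (N : ℕ), 0 < δ → δ < 1 →
              CN * (1 / ε ^ 2) * Real.log (2 / δ) ≤ (N : ℝ) →
              1 - δ <
                (experimentLaw H L T ρ₀ hO a n N).real
                  {ω | |extrapolatedEstimate a n N ω - ((ρ T * O).trace).re| < ε}) ∧
            -- maximum circuit depth
            (maxDepth a n : ℝ) = 1 / node a n 0 ∧
            c₁ * ((l * T) ^ 2 * Real.log l * (n : ℝ) ^ 2) ≤ (maxDepth a n : ℝ) ∧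
            (maxDepth a n : ℝ) ≤ C₂ * ((l * T) ^ 2 * Real.log l * (n : ℝ) ^ 2) ∧
            ((n : ℝ) ≤ B * Real.log (1 / ε) →
              (maxDepth a n : ℝ) ≤ C₂ * ((l * T) ^ 2 * Real.log l * Real.log (1 / ε) ^ 2)) := by
  -- `exp 4 ≤ A` gives `4 ≤ log n`; the last summand absorbs the constant of the bias bound.
  refine ⟨Real.exp 4 + 1 + max 0 (Real.log (8 * Real.exp 6 * M)), by positivity, fun B => ?_⟩
  set K := max 0 (Real.log (8 * Real.exp 6 * M)) with hK
  set g := min 1 (Real.log l₀) with hg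
  have hg0 : 0 < g := lt_min one_pos (Real.log_pos hl₀)
  have hB1 : 1 ≤ max B 1 := le_max_right _ _
  set B' := max B 1 with hB'
  have he10 : 1 ≤ Real.exp 10 := Real.one_le_exp (by norm_num)
  have hden : 1 ≤ 16 * Real.exp 10 * B' ^ 2 := by
    have : 1 ≤ B' ^ 2 := one_le_pow₀ hB1
    nlinarith
  -- `B' ^ 2` serves the separation of the nodes when `n ≤ B log (1 / ε)`; `16 e ^ 10` puts `a` well
  -- inside the disc of analyticity, with ratio `e ^ (-2)`; `g` compensates for `log l` near `0`.
  set c := g / (16 * Real.exp 10 * B' ^ 2) with hc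
  have hc0 : 0 < c := by positivity
  have hc1 : c ≤ 1 := (div_le_one (by positivity)).mpr ((min_le_left _ _).trans hden)
  refine ⟨c, 16 * M ^ 2 * (8 * Real.exp 5 ^ 2), 1, 32 * B' ^ 2 / c, hc0, hc1, by positivity,
    one_pos, by positivity, ?_⟩
  intro d J H L O ρ₀ ρ l T ε a hO hH hOM hρ₀ hgs hl hT hρ hε hε1 htime ha n hn hnB
  set x := Real.log (1 / ε) with hx
  have hεx : Real.exp (-x) = ε := by
    rw [hx, one_div, Real.log_inv, neg_neg, Real.exp_log hε]
  have hx1 : 1 ≤ x := by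
    rw [← hεx, Real.exp_le_exp] at hε1
    linarith
  have hK0 : 0 ≤ K := le_max_left _ _
  have hn4 : Real.exp 4 ≤ n := by
    refine le_trans ?_ hn
    nlinarith [Real.exp_pos 4]
  have hn1 : (1 : ℝ) ≤ n := (Real.one_le_exp (by norm_num)).trans hn4
  have hloglog : Real.log l₀ ≤ Real.log l := Real.log_le_log (by linarith) hl
  have hlog : 0 < Real.log l := (Real.log_pos hl₀).trans_le hloglog
  have hl0 : 0 < l := by linarith
  have hT0 : 0 < T := by linarith
  have htime' := sq_mul_le_of_time_ge hl₀ hl hT hx1 hg0.le (min_le_left _ _)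
    (min_le_right _ _) htime
  set D := (l * T) ^ 2 * Real.log l with hD
  have hD0 : 0 < D := by positivity
  have ha0 : 0 < a := ha ▸ by positivity
  have hax : a * (B' * x) ^ 2 ≤ 1 / 8 := by
    rw [ha, hc, div_div, div_mul_eq_mul_div, div_le_iff₀ (by positivity)]
    have h1 : Real.exp 1 ^ 2 ≤ Real.exp 10 := by
      rw [← Real.exp_nat_mul]
      exact Real.exp_le_exp.mpr (by norm_num)
    calc g * (B' * x) ^ 2 = B' ^ 2 * (x ^ 2 * g) := by ring
      _ ≤ B' ^ 2 * (Real.exp 10 * D) :=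
        mul_le_mul_of_nonneg_left (htime'.trans (by gcongr)) (sq_nonneg _)
      _ ≤ B' ^ 2 * (Real.exp 10 * D) * 2 := le_mul_of_one_le_right (by positivity) one_le_two
      _ = _ := by ring
  have hsep := interval_mul_sq_le ha0 hn4 (by linarith) hax hnB
  have hq : (4 * Real.exp 4 * (l * T)) ^ 2 * a ≤ Real.exp (-2) := by
    have h1 : c ≤ Real.log l / (16 * Real.exp 10) := by
      rw [hc]
      exact div_le_div₀ hlog.le ((min_le_right _ _).trans hloglog) (by positivity)
        (le_mul_of_one_le_right (by positivity) (one_le_pow₀ hB1))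
    have h2 : Real.exp 10 = Real.exp 4 * Real.exp 4 * Real.exp 2 := by
      rw [← Real.exp_add, ← Real.exp_add]
      norm_num
    calc (4 * Real.exp 4 * (l * T)) ^ 2 * a
        ≤ (4 * Real.exp 4 * (l * T)) ^ 2 * (Real.log l / (16 * Real.exp 10) / D) := by
          rw [ha]
          gcongr
      _ = (Real.exp 2)⁻¹ := by
          rw [hD, h2]
          field_simp
          norm_num
      _ = Real.exp (-2) := (Real.exp_neg 2).symm
  have hlT : 1 ≤ l * T := one_le_mul_of_one_le_of_one_le (by linarith) hT
  have hbias : |∑ j, extrapolationWeight (node a n) j *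
      ((simulatedState H L T ρ₀ (stepCount a n j) * O).trace).re - ((ρ T * O).trace).re| ≤
      ε / 2 := by
    refine (abs_bias_le hH L hT0 hlT ?_ hρ₀ hρ hOM ha0 hsep hq).trans ?_
    · rw [mul_comm]
      gcongr
    · have h1 : Real.log (8 * Real.exp 6 * M) ≤ K := le_max_right _ _
      have h2 : 8 * Real.exp 6 * M ≤ Real.exp K :=
        (Real.log_le_iff_le_exp (by positivity)).mp h1
      have h3 : Real.exp (-((n : ℝ) + 1)) ≤ Real.exp (-x) * Real.exp (-K) := by
        rw [← Real.exp_add, Real.exp_le_exp]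
        nlinarith [Real.exp_pos 4]
      calc 4 * Real.exp 6 * M * Real.exp (-((n : ℝ) + 1))
          ≤ 4 * Real.exp 6 * M * (Real.exp (-x) * Real.exp (-K)) := by gcongr
        _ = ε / 2 * (8 * Real.exp 6 * M * Real.exp (-K)) := by rw [hεx]; ring
        _ ≤ ε / 2 * (Real.exp K * Real.exp (-K)) := by gcongr
        _ = ε / 2 := by rw [← Real.exp_add, add_neg_cancel, Real.exp_zero, mul_one]
  have hmono := node_strictMono ha0 hsep
  have hupper := maxDepth_le_sq_div ha0 hsep (by exact_mod_cast hn1)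
  have haD : ∀ y : ℝ, y / a = y * D / c := fun y => by rw [ha]; field_simp
  refine ⟨⟨hmono, fun j => ⟨node_pos ha0 n j, node_lt ha0 n j⟩⟩, fun δ N hδ hδ1 hN => ?_,
    ?_, ?_, ?_, fun hnx => ?_⟩
  · exact experiment_accuracy hH L T hρ₀ hO hM hOM a n
      (sum_sq_extrapolationWeight_pos hmono.injective)
      (sum_sq_extrapolationWeight_node_le ha0 hsep) hε hbias hδ hδ1 hN
  · rw [maxDepth_eq ha0 hsep, node, one_div_one_div]
  · refine le_trans ?_ (sq_div_le_maxDepth ha0 hsep)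
    rw [haD, one_mul, le_div_iff₀ hc0, mul_comm ((n : ℝ) ^ 2)]
    exact mul_le_of_le_one_right (by positivity) hc1
  · refine hupper.trans ?_
    rw [haD]
    calc 32 * (n : ℝ) ^ 2 * D / c = 32 * 1 / c * (D * (n : ℝ) ^ 2) := by ring
      _ ≤ 32 * B' ^ 2 / c * (D * (n : ℝ) ^ 2) := by
        gcongr
        exact one_le_pow₀ hB1
  · refine hupper.trans ?_
    have h1 : (n : ℝ) ≤ B' * x :=
      hnx.trans (mul_le_mul_of_nonneg_right (le_max_left _ _) (by linarith))
    rw [haD]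
    calc 32 * (n : ℝ) ^ 2 * D / c ≤ 32 * (B' * x) ^ 2 * D / c := by gcongr
      _ = _ := by ring
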